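/- **Setting.** Let $K$ be a nonempty compact metric space, $A=C(K)$, $N\ge 2$, $\Sigma=\{1,\dots,N\}$, and let $\gamma=(\gamma_1,\dots,\gamma_N)$ be a self-similar map on $K$: each $\gamma_j:K\to K$ is a proper contraction (there are $0<c'\le c<1$ with $c'd(x,y)\le d(\gamma_j(x),\gamma_j(y))\le c\,d(x,y)$ for all $x,y$) and $K=\bigcup_j\gamma_j(K)$. For $w=(i_1,\dots,i_k)\in\Sigma^k$ put $\gamma_w=\gamma_{i_1}\circ\dots\circ\gamma_{i_k}$. Let $B_\gamma=\{b: b=\gamma_i(a)=\gamma_j(a)\text{ for some }a\in K,\ i\ne j\}$ and $P_\gamma=\{a:\gamma_w(a)\in B_\gamma\text{ for some }k\ge1,\ w\in\Sigma^k\}$. Assume **Assumption B**: (1) there is a continuous $h:K\to K$ with $h(\gamma_j(y))=y$ for all $j$ and $y$; (2) $B_\gamma$ is finite; (3) $B_\gamma\cap P_\gamma=\emptyset$. Let $\mathcal C_\gamma=\{(\gamma_j(y),y): j\in\Sigma,\ y\in K\}$ and let $X=C(\mathcal C_\gamma)$ be the Hilbert $A$-bimodule with $(a\cdot f\cdot b)(x,y)=a(x)f(x,y)b(y)$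 and $\langle f,g\rangle(y)=\sum_{j}\overline{f(\gamma_j(y),y)}\,g(\gamma_j(y),y)$. Let $X^{\otimes n}$ be its $n$-fold interior tensor power over $A$ (with $X^{\otimes 0}=A$), and, for a Hilbert module $E$, let $\mathcal L(E)$ and $\mathcal K(E)$ be the C*-algebras of adjointable and of compact operators, the latter being the closed span of the operators $\theta_{x,y}:z\mapsto x\langle y,z\rangle$. Put $$\mathcal F^{(n)}=A\otimes I+\mathcal K(X)\otimes I+\dots+\mathcal K(X^{\otimes n})\subset\mathcal L(X^{\otimes n}),$$ embedded in $\mathcal F^{(n+1)}$ by $T\mapsto T\otimes I$; the core $\mathcal F^{(\infty)}$ is the C*-inductive limit of the $\mathcal F^{(n)}$. Let $Y^{\otimes n}=C(K,\mathbb C^{\Sigma^n})$ be the free Hilbert $A$-module, so that $\mathcal L(Y^{\otimes n})=M_{N^n}(A)$ with rows and columns indexed by $\Sigma^n$ and $\theta^{Y}_{f,g}=[f_w\overline{g_{w'}}]_{w,w'}$. Embed $X^{\otimes n}$ in $Y^{\otimes n}$, preserving inner products, by $$(f_1\otimes\dots\otimes f_n)_{(i_1,\dots,i_n)}(y)=\prod_{k=1}^n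 f_k\big(\gamma_{i_k}\gamma_{i_{k+1}}\cdots\gamma_{i_n}(y),\ \gamma_{i_{k+1}}\cdots\gamma_{i_n}(y)\big)$$ (for $n=0$, by $a\mapsto a$); write $Z^{\otimes n}$ for the image and identify $X^{\otimes n}$ with it. Let $D^{\gamma^n}\subset M_{N^n}(A)$ be the set of matrices $a$ such that, whenever $\gamma_w(c)=\gamma_{w'}(c)$, the rows of $a(c)$ with indices $w,w'$ coincide and so do the columns. For $T\in M_{N^r}(A)$ and $v\in\Sigma^{s}$ let $\alpha_v(T)=[T_{w,w'}\circ\gamma_v]_{w,w'}$, and for $r\le n$ write $$T\otimes I_{n-r}=\operatorname{diag}\big(\alpha_{v}(T)\big)_{v\in\Sigma^{n-r}}\in M_{N^n}(A),$$ where the index $w=(i_1,\dots,i_n)$ belongs to the block $v=(i_{r+1},\dots,i_n)$ and has the position $(i_1,\dots,i_r)$ in it. Let $M_{N^\infty}(A)$ be the C*-inductive limit of $A\to M_N(A)\to M_{N^2}(A)\to\cdots$ along the embeddings $T\mapsto T\otimes I_1=\operatorname{diag}(\alpha_j(T))_{j\in\Sigma}$. **Theorem (matrix representation of the core).** There are *-homomorphisms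 $\Omega^{(r)}:\mathcal K(X^{\otimes r})\to M_{N^r}(A)$ and unital *-homomorphisms $\Pi^{(n)}:\mathcal F^{(n)}\to M_{N^n}(A)$ $(r,n\ge0)$ such that: 1. each $\Omega^{(r)}$ is isometric, takes values in $D^{\gamma^r}$, and is inverse to restriction: $\Omega^{(r)}(T)$ maps $Z^{\otimes r}$ into itself and acts there as $T$; moreover $\Omega^{(r)}(\theta^{Z}_{x,y})=\theta^{Y}_{x,y}$ for all $x,y\in X^{\otimes r}\cong Z^{\otimes r}$; 2. each $\Pi^{(n)}$ is isometric, and for all $T_r\in\mathcal K(X^{\otimes r})$, $0\le r\le n$, $$\Pi^{(n)}\Big(\sum_{r=0}^nT_r\otimes I_{n-r}\Big)=\sum_{r=0}^n\Omega^{(r)}(T_r)\otimes I_{n-r};$$ in particular the right-hand side does not depend on the expression of an element of $\mathcal F^{(n)}$ as $\sum_rT_r\otimes I_{n-r}$, and $\Pi^{(n)}(\theta^Z_{x,y}\otimes I_{n-r})=\theta^Y_{x,y}\otimes I_{n-r}$; 3. $\Pi^{(n+1)}(T\otimes I)=\Pi^{(n)}(T)\otimes I_1$ for every $T\in\mathcal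 F^{(n)}$; 4. there is an isometric unital *-homomorphism $\Pi^{(\infty)}:\mathcal F^{(\infty)}\to M_{N^\infty}(A)$ whose restriction to each $\mathcal F^{(n)}$ is $\Pi^{(n)}$ followed by the canonical map $M_{N^n}(A)\to M_{N^\infty}(A)$; thus the core is represented in $M_{N^\infty}(A)$ as a C*-subalgebra. -/

import Mathlib

open scoped ComplexOrder TensorProduct

set_option linter.unusedSectionVars false

noncomputable section

namespace SelfSimilar

universe u

/-! ### Self-similar maps and Assumption B -/

section SelfSimilarMaps

variable {K : Type u} [MetricSpace K] {N : ℕ}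

/-- A proper contraction: a contraction which is also bounded below by a positive constant. -/
def IsProperContraction (f : K → K) : Prop :=
  ∃ c' c : ℝ, 0 < c' ∧ c' ≤ c ∧ c < 1 ∧
    ∀ x y, c' * dist x y ≤ dist (f x) (f y) ∧ dist (f x) (f y) ≤ c * dist x y

/-- The family `γ = (γ_1, …, γ_N)` is a self-similar map on `K`. -/
structure IsSelfSimilarMap (γ : Fin N → C(K, K)) : Prop where
  properContraction : ∀ j, IsProperContraction (γ j)
  iUnion_range : ⋃ j, Set.range (γ j) = Set.univ

/-- For a word `w = (w_0, …, w_{k-1})` the composition `γ_{w_0} ∘ ⋯ ∘ γ_{w_{k-1}}`. -/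
def wordMap (γ : Fin N → C(K, K)) : ∀ k : ℕ, (Fin k → Fin N) → C(K, K)
  | 0, _ => ContinuousMap.id K
  | k + 1, w => (wordMap γ k (Fin.init w)).comp (γ (w (Fin.last k)))

/-- The branch set `B_γ`. -/
def branchSet (γ : Fin N → C(K, K)) : Set K :=
  {b | ∃ a i j, i ≠ j ∧ b = γ i a ∧ b = γ j a}

/-- The postcritical set `P_γ`. -/
def postcriticalSet (γ : Fin N → C(K, K)) : Set K :=
  {a | ∃ k, 1 ≤ k ∧ ∃ w : Fin k → Fin N, wordMap γ k w a ∈ branchSet γ}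

/-- Assumption B. -/
structure AssumptionB (γ : Fin N → C(K, K)) : Prop where
  exists_leftInverse : ∃ h : C(K, K), ∀ j y, h (γ j y) = y
  finite_branchSet : (branchSet γ).Finite
  disjoint : branchSet γ ∩ postcriticalSet γ = ∅

end SelfSimilarMaps

/-! ### Adjointable and compact operators on Hilbert modules -/

section Adjointable

variable (A E : Type u) [CStarAlgebra A] [PartialOrder A] [StarOrderedRing A]
  [NormedAddCommGroup E] [NormedSpace ℂ E] [Module A E] [CStarModule A E]

/-- The operators on a Hilbert `A`-module `E` which possess an adjoint. (Adjointable operators are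
automatically bounded, `ℂ`-linear and `A`-linear.) -/
def adjointableSubalgebra : Subalgebra ℂ (E →L[ℂ] E) where
  carrier := {T | ∃ S : E →L[ℂ] E, ∀ x y, inner A (T x) y = inner A x (S y)}
  mul_mem' := by
    rintro T T' ⟨S, hS⟩ ⟨S', hS'⟩
    exact ⟨S' * S, fun x y => by simp [hS, hS']⟩
  add_mem' := by
    rintro T T' ⟨S, hS⟩ ⟨S', hS'⟩
    exact ⟨S + S', fun x y => by simp [hS, hS']⟩
  algebraMap_mem' c := ⟨algebraMap ℂ _ (star c), fun x y => by
    simp [Algebra.algebraMap_eq_smul_one]⟩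

/-- The C*-algebra `L(E)` of adjointable operators on a Hilbert `A`-module `E`, with the operator
norm. -/
def Adjointable : Type u := adjointableSubalgebra A E

instance : NormedRing (Adjointable A E) := inferInstanceAs (NormedRing (adjointableSubalgebra A E))

instance : NormedAlgebra ℂ (Adjointable A E) :=
  inferInstanceAs (NormedAlgebra ℂ (adjointableSubalgebra A E))

variable {A E}

theorem ext_inner_left {x y : E} (h : ∀ z : E, inner A z x = inner A z y) : x = y := by
  have : inner A (x - y) (x - y) = 0 := by
    rw [CStarModule.inner_sub_right, h, sub_self]
  exact sub_eq_zero.1 (CStarModule.inner_self.1 this)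

theorem smul_complex_smul (a : A) (c : ℂ) (x : E) : a • (c • x) = c • (a • x) :=
  ext_inner_left (A := A) fun z => by simp

theorem complex_smul_smul (a : A) (c : ℂ) (x : E) : (c • a) • x = c • (a • x) :=
  ext_inner_left (A := A) fun z => by simp

theorem norm_smul_le_mul (a : A) (x : E) : ‖a • x‖ ≤ ‖a‖ * ‖x‖ := by
  have h : ‖a • x‖ ^ 2 ≤ (‖a‖ * ‖x‖) ^ 2 := by
    rw [CStarModule.norm_sq_eq A, mul_pow, CStarModule.norm_sq_eq A (x := x)]
    simp only [CStarModule.inner_op_smul_right, CStarModule.inner_op_smul_left]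
    calc ‖a * (inner A x x * star a)‖ ≤ ‖a‖ * (‖inner A x x‖ * ‖star a‖) :=
          (norm_mul_le _ _).trans (by gcongr; exact norm_mul_le _ _)
      _ = ‖a‖ ^ 2 * ‖inner A x x‖ := by rw [norm_star]; ring
  exact le_of_sq_le_sq h (by positivity)

namespace Adjointable

/-- An adjointable operator as a bounded operator. -/
def toCLM : Adjointable A E →ₐ[ℂ] (E →L[ℂ] E) := (adjointableSubalgebra A E).val

instance : CoeFun (Adjointable A E) fun _ => E → E := ⟨fun T => toCLM T⟩

/-- Construct an adjointable operator from a bounded operator and its adjoint. -/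
def mk (T S : E →L[ℂ] E) (h : ∀ x y, inner A (T x) y = inner A x (S y)) : Adjointable A E :=
  ⟨T, S, h⟩

@[simp]
theorem toCLM_mk (T S : E →L[ℂ] E) (h : ∀ x y, inner A (T x) y = inner A x (S y)) :
    toCLM (mk T S h) = T := rfl

theorem norm_toCLM (T : Adjointable A E) : ‖toCLM T‖ = ‖T‖ := rfl

theorem toCLM_injective : Function.Injective (toCLM : Adjointable A E → (E →L[ℂ] E)) :=
  Subtype.val_injective

theorem exists_adjoint (T : Adjointable A E) :
    ∃ S : E →L[ℂ] E, ∀ x y, inner A (toCLM T x) y = inner A x (S y) := T.2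

/-- The adjoint of an adjointable operator. -/
instance : Star (Adjointable A E) where
  star T := mk T.exists_adjoint.choose (toCLM T) fun x y => by
    rw [← CStarModule.star_inner, ← T.exists_adjoint.choose_spec, CStarModule.star_inner]

@[simp]
theorem inner_star_right (T : Adjointable A E) (x y : E) :
    inner A x (star T y) = inner A (T x) y := (T.exists_adjoint.choose_spec x y).symm

@[simp]
theorem inner_star_left (T : Adjointable A E) (x y : E) :
    inner A (star T x) y = inner A x (T y) := by
  rw [← CStarModule.star_inner, inner_star_right, CStarModule.star_inner]

theorem ext_inner {S T : Adjointable A E}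
    (h : ∀ x y : E, inner A x (S y) = inner A x (T y)) : S = T :=
  toCLM_injective <| ContinuousLinearMap.ext fun y => ext_inner_left (A := A) fun x => h x y

instance : StarRing (Adjointable A E) where
  star_involutive T := ext_inner fun x y => by simp
  star_mul S T := ext_inner fun x y => by simp
  star_add S T := ext_inner fun x y => by simp

instance : StarModule ℂ (Adjointable A E) where
  star_smul c T := ext_inner fun x y => by simp

/-- Adjointable operators are `A`-linear. -/
theorem apply_smul (T : Adjointable A E) (a : A) (x : E) : T (a • x) = a • T x :=
  ext_inner_left (A := A) fun z => by
    rw [← inner_star_left]; simp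

/-- The bounded operator `z ↦ x ⟨y, z⟩`. -/
def rankOneCLM (x y : E) : E →L[ℂ] E :=
  LinearMap.mkContinuous
    { toFun := fun z => inner A y z • x
      map_add' := fun z w => by simp [add_smul]
      map_smul' := fun c z => by simp [complex_smul_smul] }
    (‖y‖ * ‖x‖) (fun z => by
      refine (norm_smul_le_mul _ _).trans ?_
      have := CStarModule.norm_inner_le (A := A) E (x := y) (y := z)
      calc ‖inner A y z‖ * ‖x‖ ≤ (‖y‖ * ‖z‖) * ‖x‖ := by gcongr
        _ = ‖y‖ * ‖x‖ * ‖z‖ := by ring)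

@[simp]
theorem rankOneCLM_apply (x y z : E) : rankOneCLM (A := A) x y z = inner A y z • x := rfl

/-- The rank-one operator `θ_{x,y} : z ↦ x ⟨y, z⟩`. -/
def rankOne (x y : E) : Adjointable A E :=
  mk (rankOneCLM (A := A) x y) (rankOneCLM (A := A) y x) fun z w => by simp

@[simp]
theorem rankOne_apply (x y z : E) : rankOne (A := A) x y z = inner A y z • x := rfl

theorem star_rankOne (x y : E) : star (rankOne (A := A) x y) = rankOne y x :=
  ext_inner fun z w => by simp

theorem mul_rankOne (T : Adjointable A E) (x y : E) :
    T * rankOne x y = rankOne (T x) y :=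
  ext_inner fun z w => by simp [apply_smul]

theorem norm_star_le (T : Adjointable A E) : ‖star T‖ ≤ ‖T‖ := by
  rw [← norm_toCLM]
  refine ContinuousLinearMap.opNorm_le_bound _ (norm_nonneg _) fun x => ?_
  by_cases hx : ‖star T x‖ = 0
  · rw [hx]; positivity
  have h : ‖star T x‖ * ‖star T x‖ ≤ ‖T‖ * ‖x‖ * ‖star T x‖ := by
    rw [← sq, CStarModule.norm_sq_eq A, inner_star_right]
    refine (CStarModule.norm_inner_le E).trans ?_
    have := (toCLM T).le_opNorm (star T x)
    rw [norm_toCLM] at this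
    calc ‖T (star T x)‖ * ‖x‖ ≤ (‖T‖ * ‖star T x‖) * ‖x‖ := by gcongr
      _ = _ := by ring
  exact le_of_mul_le_mul_right h (lt_of_le_of_ne (norm_nonneg _) (Ne.symm hx))

instance : NormedStarGroup (Adjointable A E) where
  norm_star_le := norm_star_le

variable (A E)

/-- The compact operators `𝒦(E)`: the norm closure of the linear span of the rank-one operators. -/
def compactsSubmodule : Submodule ℂ (Adjointable A E) :=
  (Submodule.span ℂ (Set.range fun p : E × E => rankOne (A := A) p.1 p.2)).topologicalClosure

variable {A E}

theorem rankOne_mem (x y : E) : rankOne x y ∈ compactsSubmodule A E :=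
  Submodule.le_topologicalClosure _ (Submodule.subset_span ⟨(x, y), rfl⟩)

/-- To check that a continuous linear map sends compact operators to a closed subspace, it is enough
to consider the rank-one operators. -/
theorem compacts_induction {F : Type u} [NormedAddCommGroup F] [NormedSpace ℂ F]
    (f : Adjointable A E → F) (hf : Continuous f) (hadd : ∀ S T, f (S + T) = f S + f T)
    (hz : f 0 = 0) (hsmul : ∀ (c : ℂ) T, ∃ d : ℂ, f (c • T) = d • f T)
    (P : Submodule ℂ F) (hP : IsClosed (P : Set F))
    (h : ∀ x y : E, f (rankOne x y) ∈ P) {T : Adjointable A E} (hT : T ∈ compactsSubmodule A E) :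
    f T ∈ P := by
  have hcl : IsClosed (f ⁻¹' (P : Set F)) := hP.preimage hf
  have : ((compactsSubmodule A E : Submodule ℂ (Adjointable A E)) : Set (Adjointable A E)) ⊆
      f ⁻¹' (P : Set F) := by
    refine closure_minimal ?_ hcl
    intro S hS
    induction hS using Submodule.span_induction with
    | mem S hS => obtain ⟨p, rfl⟩ := hS; exact h _ _
    | zero => simp [hz]
    | add S T _ _ hS hT => simpa [hadd] using P.add_mem hS hT
    | smul c S _ hS => obtain ⟨d, hd⟩ := hsmul c S; simpa [hd] using P.smul_mem d hS
  exact this hT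

theorem isClosed_compactsSubmodule :
    IsClosed (compactsSubmodule A E : Set (Adjointable A E)) :=
  Submodule.isClosed_topologicalClosure _

theorem mul_mem_compacts (S : Adjointable A E) {T : Adjointable A E}
    (hT : T ∈ compactsSubmodule A E) : S * T ∈ compactsSubmodule A E :=
  compacts_induction (fun T => S * T) (continuous_const.mul continuous_id) (mul_add S) (mul_zero S)
    (fun c T => ⟨c, mul_smul_comm c S T⟩) _ isClosed_compactsSubmodule
    (fun x y => by rw [mul_rankOne]; exact rankOne_mem _ _) hT

theorem star_mem_compacts {T : Adjointable A E}
    (hT : T ∈ compactsSubmodule A E) : star T ∈ compactsSubmodule A E :=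
  compacts_induction star continuous_star star_add (star_zero _)
    (fun c T => ⟨star c, star_smul c T⟩) _ isClosed_compactsSubmodule
    (fun x y => by rw [star_rankOne]; exact rankOne_mem _ _) hT

theorem mem_compacts_mul (S : Adjointable A E) {T : Adjointable A E}
    (hT : T ∈ compactsSubmodule A E) : T * S ∈ compactsSubmodule A E := by
  have := star_mem_compacts (mul_mem_compacts (star S) (star_mem_compacts hT))
  rwa [star_mul, star_star, star_star] at this

variable (A E)

/-- The C*-algebra `𝒦(E)` of compact operators, as a closed *-subalgebra of `L(E)`. -/
def compacts : NonUnitalStarSubalgebra ℂ (Adjointable A E) where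
  __ := compactsSubmodule A E
  mul_mem' := fun {S _} _ hT => mul_mem_compacts S hT
  star_mem' := star_mem_compacts

end Adjointable

end Adjointable

/-! ### The correspondence `X_γ` and interior tensor products with it -/

section Correspondence

variable {K : Type u} [MetricSpace K] {N : ℕ} (γ : Fin N → C(K, K))

/-- The cograph `𝒞_γ = {(γ_j(y), y)}`. -/
def cograph : Set (K × K) := {p | ∃ j, p.1 = γ j p.2}

/-- The underlying space of the correspondence `X_γ = C(𝒞_γ)`. -/
abbrev Corr : Type u := C(cograph γ, ℂ)

/-- The map `y ↦ (γ_j(y), y)`. -/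
def cographMap (j : Fin N) : C(K, cograph γ) where
  toFun y := ⟨(γ j y, y), j, rfl⟩
  continuous_toFun := by fun_prop

namespace Corr

variable {γ}

/-- The left action `(a · f)(γ_j(y), y) = a(γ_j(y)) f(γ_j(y), y)`. -/
def leftAct (a : C(K, ℂ)) (f : Corr γ) : Corr γ :=
  a.comp ⟨fun p => p.1.1, by fun_prop⟩ * f

/-- The right action `(f · b)(γ_j(y), y) = f(γ_j(y), y) b(y)`. -/
def rightAct (f : Corr γ) (b : C(K, ℂ)) : Corr γ :=
  f * b.comp ⟨fun p => p.1.2, by fun_prop⟩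

/-- The inner product `(f | g)(y) = ∑_j conj f(γ_j(y), y) g(γ_j(y), y)`. -/
def innerProd (f g : Corr γ) : C(K, ℂ) :=
  ∑ j, (star f * g).comp (cographMap γ j)

@[simp]
theorem leftAct_cographMap (a : C(K, ℂ)) (f : Corr γ) (j : Fin N) (y : K) :
    leftAct a f (cographMap γ j y) = a (γ j y) * f (cographMap γ j y) := rfl

@[simp]
theorem rightAct_cographMap (b : C(K, ℂ)) (f : Corr γ) (j : Fin N) (y : K) :
    rightAct f b (cographMap γ j y) = f (cographMap γ j y) * b y := rfl

@[simp]
theorem innerProd_apply (f g : Corr γ) (y : K) :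
    innerProd f g y = ∑ j, star (f (cographMap γ j y)) * g (cographMap γ j y) := by
  simp [innerProd]

/-- The right action as a bilinear map. -/
def rightActₗ : C(K, ℂ) →ₗ[ℂ] Corr γ →ₗ[ℂ] Corr γ :=
  LinearMap.mk₂ ℂ (fun b f => rightAct f b)
    (fun b b' f => by ext; simp [rightAct, mul_add])
    (fun c b f => by ext; simp [rightAct]; ring)
    (fun b f f' => by ext; simp [rightAct, add_mul])
    (fun c b f => by ext; simp [rightAct]; ring)

end Corr

variable [CompactSpace K]
variable (E : Type u) [NormedAddCommGroup E] [NormedSpace ℂ E] [Module C(K, ℂ) E]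
  [CStarModule C(K, ℂ) E]

/-- The algebraic tensor product `E ⊙ X_γ` of a Hilbert `C(K)`-module `E` and `X_γ`. -/
def AlgTensor : Type u := E ⊗[ℂ] Corr γ

namespace AlgTensor

instance : AddCommGroup (AlgTensor γ E) := inferInstanceAs (AddCommGroup (E ⊗[ℂ] Corr γ))

instance : Module ℂ (AlgTensor γ E) := inferInstanceAs (Module ℂ (E ⊗[ℂ] Corr γ))

variable {γ E}

/-- The elementary tensor `x ⊗ f`. -/
def tmul (x : E) (f : Corr γ) : AlgTensor γ E := x ⊗ₜ[ℂ] f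

theorem induction {P : AlgTensor γ E → Prop} (t : AlgTensor γ E) (h0 : P 0)
    (ht : ∀ x f, P (tmul x f)) (ha : ∀ s t, P s → P t → P (s + t)) : P t :=
  TensorProduct.induction_on t h0 ht ha

/-- The right `C(K)`-module structure `(x ⊗ f) · b = x ⊗ (f · b)`. -/
instance : Module C(K, ℂ) (AlgTensor γ E) where
  smul b t := TensorProduct.map LinearMap.id (Corr.rightActₗ b) t
  one_smul t := by
    change TensorProduct.map LinearMap.id (Corr.rightActₗ 1) t = t
    have : Corr.rightActₗ (γ := γ) 1 = LinearMap.id := by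
      ext f p; simp [Corr.rightActₗ, Corr.rightAct]
    rw [this, TensorProduct.map_id]; rfl
  mul_smul a b t := by
    change TensorProduct.map LinearMap.id (Corr.rightActₗ (a * b)) t =
      TensorProduct.map LinearMap.id (Corr.rightActₗ a)
        (TensorProduct.map LinearMap.id (Corr.rightActₗ b) t)
    have : Corr.rightActₗ (γ := γ) (a * b) = Corr.rightActₗ a ∘ₗ Corr.rightActₗ b := by
      ext f p; simp [Corr.rightActₗ, Corr.rightAct]; ring
    have h2 := TensorProduct.map_comp (LinearMap.id : E →ₗ[ℂ] E) (Corr.rightActₗ (γ := γ) a)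
      LinearMap.id (Corr.rightActₗ b)
    rw [LinearMap.id_comp] at h2
    rw [this, h2]; rfl
  smul_zero b := map_zero _
  smul_add b := map_add _
  add_smul a b t := by
    change TensorProduct.map LinearMap.id (Corr.rightActₗ (a + b)) t =
      TensorProduct.map LinearMap.id (Corr.rightActₗ a) t +
        TensorProduct.map LinearMap.id (Corr.rightActₗ b) t
    rw [map_add, TensorProduct.map_add_right]; rfl
  zero_smul t := by
    change TensorProduct.map LinearMap.id (Corr.rightActₗ 0) t = 0
    rw [map_zero, TensorProduct.map_zero_right]; rfl

@[simp]
theorem smul_tmul (b : C(K, ℂ)) (x : E) (f : Corr γ) :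
    b • tmul x f = tmul x (Corr.rightAct f b) := rfl

/-- The linear map `x' ⊗ f' ↦ (f | ⟨x, x'⟩ · f')`. -/
def formAux (x : E) (f : Corr γ) : E ⊗[ℂ] Corr γ →ₗ[ℂ] C(K, ℂ) :=
  TensorProduct.lift <| LinearMap.mk₂ ℂ
    (fun x' f' => Corr.innerProd f (Corr.leftAct (inner C(K, ℂ) x x') f'))
    (fun x₁ x₂ f' => by ext y; simp [add_mul, mul_add, Finset.sum_add_distrib])
    (fun c x' f' => by ext y; simp [Finset.mul_sum, mul_left_comm, mul_assoc])
    (fun x' f₁ f₂ => by ext y; simp [mul_add, Finset.sum_add_distrib])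
    (fun c x' f' => by ext y; simp [Finset.mul_sum, mul_left_comm])

@[simp]
theorem formAux_tmul (x x' : E) (f f' : Corr γ) :
    formAux x f (x' ⊗ₜ[ℂ] f') = Corr.innerProd f (Corr.leftAct (inner C(K, ℂ) x x') f') := rfl

/-- The sesquilinear map `⟨x ⊗ f, x' ⊗ f'⟩ = (f | ⟨x, x'⟩ · f')`. -/
def formTensor : E ⊗[ℂ] Corr γ →ₗ⋆[ℂ] E ⊗[ℂ] Corr γ →ₗ[ℂ] C(K, ℂ) :=
  TensorProduct.lift <| LinearMap.mk₂'ₛₗ (starRingEnd ℂ) (starRingEnd ℂ) formAux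
    (fun x₁ x₂ f => TensorProduct.ext' fun x' f' => by
      ext y; simp [add_mul, mul_add, Finset.sum_add_distrib])
    (fun c x f => TensorProduct.ext' fun x' f' => by
      ext y
      simp only [formAux_tmul, LinearMap.smul_apply, ContinuousMap.smul_apply,
        Corr.innerProd_apply, Corr.leftAct_cographMap, CStarModule.inner_smul_left_complex,
        smul_eq_mul, Finset.mul_sum]
      exact Finset.sum_congr rfl fun j _ => by simp; ring)
    (fun x f₁ f₂ => TensorProduct.ext' fun x' f' => by
      ext y; simp [add_mul, Finset.sum_add_distrib])
    (fun c x f => TensorProduct.ext' fun x' f' => by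
      ext y; simp [Finset.mul_sum, mul_assoc])

/-- The `C(K)`-valued semi-inner product
`⟨x ⊗ f, x' ⊗ f'⟩ = (f | ⟨x, x'⟩ · f')` on the algebraic tensor product. -/
def form : AlgTensor γ E →ₗ⋆[ℂ] AlgTensor γ E →ₗ[ℂ] C(K, ℂ) := formTensor

@[simp]
theorem form_tmul (x x' : E) (f f' : Corr γ) :
    form (tmul x f) (tmul x' f') = Corr.innerProd f (Corr.leftAct (inner C(K, ℂ) x x') f') := rfl

/-- The slice `x ⊗ f ↦ f(γ_j(y), y) x`. -/
def slice (j : Fin N) (y : K) : AlgTensor γ E →ₗ[ℂ] E :=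
  TensorProduct.lift <| LinearMap.mk₂ ℂ (fun x f => f (cographMap γ j y) • x)
    (fun x₁ x₂ f => by simp) (fun c x f => smul_comm _ _ _)
    (fun x f₁ f₂ => by simp [add_smul]) (fun c x f => by simp [mul_smul])

@[simp]
theorem slice_tmul (j : Fin N) (y : K) (x : E) (f : Corr γ) :
    slice j y (tmul x f) = f (cographMap γ j y) • x := rfl

theorem form_apply (s t : AlgTensor γ E) (y : K) :
    form s t y = ∑ j, inner C(K, ℂ) (slice j y s) (slice j y t) (γ j y) := by
  induction s using induction with
  | h0 => simp
  | ha s₁ s₂ h₁ h₂ => simp [h₁, h₂, Finset.sum_add_distrib]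
  | ht x f =>
    induction t using induction with
    | h0 => simp
    | ha s₁ s₂ h₁ h₂ => simp [h₁, h₂, Finset.sum_add_distrib]
    | ht x' f' =>
      simp only [form_tmul, Corr.innerProd_apply, Corr.leftAct_cographMap, slice_tmul,
        CStarModule.inner_smul_left_complex, CStarModule.inner_smul_right_complex,
        ContinuousMap.smul_apply, smul_eq_mul]
      exact Finset.sum_congr rfl fun j _ => by ring

theorem star_form (s t : AlgTensor γ E) : star (form s t) = form t s := by
  ext y
  simp only [ContinuousMap.star_apply, form_apply, star_sum]
  simp only [← ContinuousMap.star_apply, CStarModule.star_inner]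

theorem form_self_nonneg (t : AlgTensor γ E) : 0 ≤ form t t := by
  intro y
  change 0 ≤ form t t y
  rw [form_apply]
  exact Finset.sum_nonneg fun j _ =>
    (CStarModule.inner_self_nonneg (A := C(K, ℂ)) (x := slice j y t)) (γ j y)

theorem slice_smul (b : C(K, ℂ)) (j : Fin N) (y : K) (t : AlgTensor γ E) :
    slice j y (b • t) = b y • slice j y t := by
  induction t using induction with
  | h0 => simp
  | ha s₁ s₂ h₁ h₂ => simp [h₁, h₂]
  | ht x f => rw [smul_tmul, slice_tmul, slice_tmul, Corr.rightAct_cographMap, mul_comm, mul_smul]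

theorem form_smul (b : C(K, ℂ)) (s t : AlgTensor γ E) : form s (b • t) = b * form s t := by
  ext y
  simp [form_apply, slice_smul, Finset.mul_sum]

/-- Cauchy–Schwarz for the semi-inner product. -/
theorem norm_form_sq_le (s t : AlgTensor γ E) :
    ‖form s t‖ ^ 2 ≤ ‖form s s‖ * ‖form t t‖ := by
  have key : ∀ y, ‖form s t y‖ ^ 2 ≤ ‖form s s‖ * ‖form t t‖ := fun y => by
    let c : PreInnerProductSpace.Core ℂ (AlgTensor γ E) :=
      { inner := fun s t => form s t y
        conj_inner_symm := fun s t => congrArg (fun g : C(K, ℂ) => g y) (star_form t s)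
        re_inner_nonneg := fun t => (Complex.le_def.1 (form_self_nonneg t y)).1
        add_left := fun s t r => by simp
        smul_left := fun s t r => by simp }
    have h := @InnerProductSpace.Core.inner_mul_inner_self_le ℂ (AlgTensor γ E) _ _ _ c s t
    have h1 : ‖form t s y‖ = ‖form s t y‖ := by
      rw [← star_form s t, ContinuousMap.star_apply, norm_star]
    change ‖form s t y‖ * ‖form t s y‖ ≤ (form s s y).re * (form t t y).re at h
    rw [h1, ← sq] at h
    refine h.trans ?_
    gcongr
    · exact (Complex.le_def.1 (form_self_nonneg t y)).1
    · exact (Complex.re_le_norm _).trans (ContinuousMap.norm_coe_le_norm _ _)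
    · exact (Complex.re_le_norm _).trans (ContinuousMap.norm_coe_le_norm _ _)
  have h2 : ‖form s t‖ ≤ √(‖form s s‖ * ‖form t t‖) :=
    (ContinuousMap.norm_le _ (by positivity)).2 fun y =>
      Real.le_sqrt_of_sq_le (key y)
  calc ‖form s t‖ ^ 2 ≤ √(‖form s s‖ * ‖form t t‖) ^ 2 := by gcongr
    _ = _ := Real.sq_sqrt (by positivity)

theorem norm_form_le (s t : AlgTensor γ E) : ‖form s t‖ ≤ √‖form s s‖ * √‖form t t‖ := by
  rw [← Real.sqrt_mul (norm_nonneg _)]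
  exact Real.le_sqrt_of_sq_le (norm_form_sq_le s t)

/-- The seminorm `‖t‖ = ‖⟨t, t⟩‖^{1/2}`. -/
instance : SeminormedAddCommGroup (AlgTensor γ E) :=
  AddGroupSeminorm.toSeminormedAddCommGroup
    { toFun := fun t => √‖form t t‖
      map_zero' := by simp
      neg' := fun t => by simp
      add_le' := fun s t => by
        refine Real.sqrt_le_iff.2 ⟨by positivity, ?_⟩
        have h1 := norm_form_le s t
        have h2 := norm_form_le t s
        have h3 : form (s + t) (s + t) = form s s + form s t + (form t s + form t t) := by
          simp only [map_add, LinearMap.add_apply]; abel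
        rw [h3]
        have h4 := norm_add_le (form s s + form s t) (form t s + form t t)
        have h5 := norm_add_le (form s s) (form s t)
        have h6 := norm_add_le (form t s) (form t t)
        have h7 := Real.sq_sqrt (norm_nonneg (form s s))
        have h8 := Real.sq_sqrt (norm_nonneg (form t t))
        nlinarith }

theorem norm_def (t : AlgTensor γ E) : ‖t‖ = √‖form t t‖ := rfl

instance : NormedSpace ℂ (AlgTensor γ E) where
  norm_smul_le c t := by
    rw [norm_def, norm_def]
    simp only [map_smul, LinearMap.map_smulₛₗ, LinearMap.smul_apply, norm_smul, RCLike.norm_conj,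
      ← mul_assoc]
    rw [Real.sqrt_mul (by positivity), Real.sqrt_mul_self (norm_nonneg _)]

instance : IsBoundedSMul C(K, ℂ) (AlgTensor γ E) := IsBoundedSMul.of_norm_smul_le fun b t => by
  have h : form (b • t) (b • t) = b * (form t t * star b) := by
    rw [form_smul, ← star_form, form_smul, star_mul, star_form]
  rw [norm_def, norm_def, h]
  refine Real.sqrt_le_iff.2 ⟨by positivity, ?_⟩
  rw [mul_pow, Real.sq_sqrt (norm_nonneg _)]
  calc ‖b * (form t t * star b)‖ ≤ ‖b‖ * (‖form t t‖ * ‖star b‖) :=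
        (norm_mul_le _ _).trans (by gcongr; exact norm_mul_le _ _)
    _ = ‖b‖ ^ 2 * ‖form t t‖ := by rw [norm_star]; ring

instance : Inner C(K, ℂ) (AlgTensor γ E) := ⟨fun s t => form s t⟩

theorem inner_def (s t : AlgTensor γ E) : inner C(K, ℂ) s t = form s t := rfl

/-- The semi-inner product as a continuous sesquilinear map. -/
def formL : AlgTensor γ E →L⋆[ℂ] AlgTensor γ E →L[ℂ] C(K, ℂ) :=
  LinearMap.mkContinuous₂ form 1 fun s t => by
    rw [one_mul]; exact norm_form_le s t

theorem continuous_inner :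
    Continuous (Function.uncurry (inner C(K, ℂ) (E := AlgTensor γ E))) := by
  change Continuous fun p : AlgTensor γ E × AlgTensor γ E => formL p.1 p.2
  fun_prop

end AlgTensor

/-- The interior tensor product `E ⊗_{C(K)} X_γ`: the Hausdorff completion of the algebraic tensor
product with respect to its `C(K)`-valued semi-inner product. -/
def InteriorTensor : Type u := UniformSpace.Completion (AlgTensor γ E)

namespace InteriorTensor

open UniformSpace

instance : NormedAddCommGroup (InteriorTensor γ E) :=
  inferInstanceAs (NormedAddCommGroup (Completion (AlgTensor γ E)))

instance : NormedSpace ℂ (InteriorTensor γ E) :=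
  inferInstanceAs (NormedSpace ℂ (Completion (AlgTensor γ E)))

instance : CompleteSpace (InteriorTensor γ E) :=
  inferInstanceAs (CompleteSpace (Completion (AlgTensor γ E)))

instance : Module C(K, ℂ) (InteriorTensor γ E) :=
  inferInstanceAs (Module C(K, ℂ) (Completion (AlgTensor γ E)))

instance : UniformContinuousConstSMul C(K, ℂ) (InteriorTensor γ E) :=
  inferInstanceAs (UniformContinuousConstSMul C(K, ℂ) (Completion (AlgTensor γ E)))

instance : Inner C(K, ℂ) (InteriorTensor γ E) :=
  inferInstanceAs (Inner C(K, ℂ) (Completion (AlgTensor γ E)))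

variable {γ E}

/-- The canonical map from the algebraic tensor product. -/
def ofAlg : AlgTensor γ E →L[ℂ] InteriorTensor γ E :=
  (Completion.toComplL : AlgTensor γ E →L[ℂ] Completion (AlgTensor γ E))

/-- The elementary tensor `x ⊗ f`. -/
def tmul (x : E) (f : Corr γ) : InteriorTensor γ E := ofAlg (AlgTensor.tmul x f)

theorem norm_ofAlg (t : AlgTensor γ E) : ‖ofAlg t‖ = ‖t‖ := Completion.norm_coe t

theorem denseRange_ofAlg : DenseRange (ofAlg : AlgTensor γ E → InteriorTensor γ E) :=
  Completion.denseRange_coe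

theorem isUniformInducing_ofAlg :
    IsUniformInducing (ofAlg : AlgTensor γ E → InteriorTensor γ E) :=
  Completion.isUniformInducing_coe _

theorem ofAlg_smul (b : C(K, ℂ)) (t : AlgTensor γ E) : ofAlg (b • t) = b • ofAlg t :=
  Completion.coe_smul b t

theorem inner_ofAlg (s t : AlgTensor γ E) :
    inner C(K, ℂ) (ofAlg s) (ofAlg t) = AlgTensor.form s t :=
  (Completion.isDenseInducing_coe.prodMap Completion.isDenseInducing_coe).extend_eq
    AlgTensor.continuous_inner (s, t)

theorem continuous_inner :
    Continuous (Function.uncurry (inner C(K, ℂ) (E := InteriorTensor γ E))) := by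
  let form' : AlgTensor γ E →+ AlgTensor γ E →+ C(K, ℂ) :=
    { toFun := fun x => (AlgTensor.form x).toAddMonoidHom
      map_zero' := by ext; simp
      map_add' := fun x y => by ext; simp }
  have : Continuous fun p : AlgTensor γ E × AlgTensor γ E => form' p.1 p.2 :=
    AlgTensor.continuous_inner
  exact (Completion.isDenseInducing_toCompl (AlgTensor γ E)).extend_Z_bilin
    (Completion.isDenseInducing_toCompl (AlgTensor γ E)) this

theorem continuous_inner_comp {Y : Type*} [TopologicalSpace Y] {f g : Y → InteriorTensor γ E}
    (hf : Continuous f) (hg : Continuous g) : Continuous fun y => inner C(K, ℂ) (f y) (g y) :=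
  continuous_inner.comp (hf.prodMk hg)

theorem norm_eq (x : InteriorTensor γ E) : ‖x‖ = √‖inner C(K, ℂ) x x‖ := by
  refine denseRange_ofAlg.induction_on x (isClosed_eq continuous_norm
    (Real.continuous_sqrt.comp (continuous_inner_comp continuous_id continuous_id).norm)) ?_
  intro t
  rw [norm_ofAlg, inner_ofAlg, AlgTensor.norm_def]

theorem inner_eq_zero (x : InteriorTensor γ E) : inner C(K, ℂ) x x = 0 ↔ x = 0 := by
  constructor
  · intro h
    rw [← norm_eq_zero, norm_eq, h, norm_zero, Real.sqrt_zero]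
  · rintro rfl
    have h := inner_ofAlg (0 : AlgTensor γ E) 0
    rwa [map_zero, map_zero] at h

instance : CStarModule C(K, ℂ) (InteriorTensor γ E) where
  inner_add_right {x y z} := by
    refine denseRange_ofAlg.induction_on₃ ?_ ?_ x y z
    · exact isClosed_eq
        (continuous_inner_comp continuous_fst (continuous_snd.fst.add continuous_snd.snd))
        ((continuous_inner_comp continuous_fst continuous_snd.fst).add
          (continuous_inner_comp continuous_fst continuous_snd.snd))
    · intro r s t
      rw [← map_add, inner_ofAlg, inner_ofAlg, inner_ofAlg, map_add]
  inner_self_nonneg {x} := by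
    refine denseRange_ofAlg.induction_on x ?_ ?_
    · exact isClosed_Ici.preimage (continuous_inner_comp continuous_id continuous_id)
    · intro t
      rw [inner_ofAlg]; exact AlgTensor.form_self_nonneg t
  inner_self {x} := inner_eq_zero x
  inner_op_smul_right {b x y} := by
    refine denseRange_ofAlg.induction_on₂ ?_ ?_ x y
    · have h : Continuous fun p : InteriorTensor γ E × InteriorTensor γ E =>
          inner C(K, ℂ) p.1 p.2 := continuous_inner_comp continuous_fst continuous_snd
      have hb : Continuous fun p : InteriorTensor γ E × InteriorTensor γ E => b • p.2 :=
        (uniformContinuous_const_smul b).continuous.comp continuous_snd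
      exact isClosed_eq (continuous_inner_comp continuous_fst hb) (continuous_const.mul h)
    · intro s t
      rw [← ofAlg_smul, inner_ofAlg, inner_ofAlg, AlgTensor.form_smul]
  inner_smul_right_complex {c x y} := by
    refine denseRange_ofAlg.induction_on₂ ?_ ?_ x y
    · have h : Continuous fun p : InteriorTensor γ E × InteriorTensor γ E =>
          inner C(K, ℂ) p.1 p.2 := continuous_inner_comp continuous_fst continuous_snd
      exact isClosed_eq (continuous_inner_comp continuous_fst (continuous_snd.const_smul c))
        (h.const_smul c)
    · intro s t
      rw [← map_smul, inner_ofAlg, inner_ofAlg, map_smul]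
  star_inner x y := by
    refine denseRange_ofAlg.induction_on₂ ?_ ?_ x y
    · have h : Continuous fun p : InteriorTensor γ E × InteriorTensor γ E =>
          inner C(K, ℂ) p.1 p.2 := continuous_inner_comp continuous_fst continuous_snd
      exact isClosed_eq (continuous_star.comp h)
        (continuous_inner_comp continuous_snd continuous_fst)
    · intro s t
      rw [inner_ofAlg, inner_ofAlg, AlgTensor.star_form]
  norm_eq_sqrt_norm_inner_self := norm_eq

theorem inner_tmul (x x' : E) (f f' : Corr γ) :
    inner C(K, ℂ) (tmul x f) (tmul x' f') =
      Corr.innerProd f (Corr.leftAct (inner C(K, ℂ) x x') f') := by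
  rw [tmul, tmul, inner_ofAlg, AlgTensor.form_tmul]

end InteriorTensor

end Correspondence

/-! ### The operators `T ⊗ I` -/

section Amplification

variable {K : Type u} [MetricSpace K] [CompactSpace K] {N : ℕ} {γ : Fin N → C(K, K)}
variable {E : Type u} [NormedAddCommGroup E] [NormedSpace ℂ E] [Module C(K, ℂ) E]
  [CStarModule C(K, ℂ) E]

theorem inner_self_re_nonneg (x : E) (y : K) : 0 ≤ (inner C(K, ℂ) x x y).re :=
  (Complex.le_def.1 ((CStarModule.inner_self_nonneg (A := C(K, ℂ)) (x := x)) y)).1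

/-- The pointwise inequality `⟨Tx, Tx⟩ ≤ ‖T‖² ⟨x, x⟩`. -/
theorem Adjointable.inner_apply_apply_le (T : Adjointable C(K, ℂ) E) (x : E) (y : K) :
    (inner C(K, ℂ) (T x) (T x) y).re ≤ ‖T‖ ^ 2 * (inner C(K, ℂ) x x y).re := by
  have key : ∀ ε > 0, (inner C(K, ℂ) (T x) (T x) y).re ≤
      ‖T‖ ^ 2 * ((inner C(K, ℂ) x x y).re + ε) := by
    intro ε hε
    have hpos : ∀ z, 0 < (inner C(K, ℂ) x x z).re + ε := fun z =>
      add_pos_of_nonneg_of_pos (inner_self_re_nonneg x z) hε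
    let a : C(K, ℂ) := ⟨fun z => ((√((inner C(K, ℂ) x x z).re + ε))⁻¹ : ℝ), by
      refine Complex.continuous_ofReal.comp (Continuous.inv₀ (by fun_prop) fun z => ?_)
      exact (Real.sqrt_pos.2 (hpos z)).ne'⟩
    have ha : ∀ (w : E) z, inner C(K, ℂ) (a • w) (a • w) z =
        ((inner C(K, ℂ) x x z).re + ε)⁻¹ * inner C(K, ℂ) w w z := by
      intro w z
      have h1 : a z * star (a z) = (((inner C(K, ℂ) x x z).re + ε)⁻¹ : ℝ) := by
        change (((√((inner C(K, ℂ) x x z).re + ε))⁻¹ : ℝ) : ℂ) *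
          star (((√((inner C(K, ℂ) x x z).re + ε))⁻¹ : ℝ) : ℂ) = _
        rw [RCLike.star_def, Complex.conj_ofReal, ← Complex.ofReal_mul, ← mul_inv,
          Real.mul_self_sqrt (hpos z).le]
      simp only [CStarModule.inner_op_smul_right, CStarModule.inner_op_smul_left,
        ContinuousMap.mul_apply, ContinuousMap.star_apply]
      rw [mul_left_comm, h1, mul_comm]
    have hnorm : ‖a • x‖ ≤ 1 := by
      have h2 : ‖a • x‖ ^ 2 ≤ 1 ^ 2 := by
        rw [CStarModule.norm_sq_eq C(K, ℂ), one_pow]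
        refine (ContinuousMap.norm_le _ zero_le_one).2 fun z => ?_
        have hr : inner C(K, ℂ) x x z = ((inner C(K, ℂ) x x z).re : ℂ) := by
          have := (Complex.le_def.1
            ((CStarModule.inner_self_nonneg (A := C(K, ℂ)) (x := x)) z)).2
          exact Complex.ext rfl (by simpa using this.symm)
        rw [ha, hr, Complex.ofReal_re, ← Complex.ofReal_mul, Complex.norm_real, Real.norm_of_nonneg
            (mul_nonneg (inv_nonneg.2 (hpos z).le) (inner_self_re_nonneg x z)),
          inv_mul_le_iff₀ (hpos z)]
        linarith
      exact le_of_sq_le_sq h2 zero_le_one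
    have hT : ‖T (a • x)‖ ≤ ‖T‖ := by
      have := (toCLM T).le_opNorm (a • x)
      rw [norm_toCLM] at this
      exact this.trans (mul_le_of_le_one_right (norm_nonneg _) hnorm)
    have h3 : ((inner C(K, ℂ) x x y).re + ε)⁻¹ * (inner C(K, ℂ) (T x) (T x) y).re ≤ ‖T‖ ^ 2 := by
      have h4 : ‖inner C(K, ℂ) (T (a • x)) (T (a • x)) y‖ ≤ ‖T‖ ^ 2 := by
        refine (ContinuousMap.norm_coe_le_norm _ _).trans ?_
        rw [← CStarModule.norm_sq_eq C(K, ℂ)]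
        gcongr
      rw [apply_smul, ha] at h4
      have h5 := (Complex.re_le_norm _).trans h4
      rwa [Complex.re_ofReal_mul] at h5
    rw [inv_mul_le_iff₀ (hpos y)] at h3
    linarith
  refine le_of_forall_pos_le_add fun δ hδ => ?_
  have h := key (δ / (‖T‖ ^ 2 + 1)) (by positivity)
  have h2 : ‖T‖ ^ 2 * (δ / (‖T‖ ^ 2 + 1)) ≤ δ := by
    rw [← mul_div_assoc, div_le_iff₀ (by positivity)]
    nlinarith
  linarith

/-- The operator `T ⊗ I` on the algebraic tensor product. -/
def AlgTensor.ampl (T : Adjointable C(K, ℂ) E) : AlgTensor γ E →ₗ[ℂ] AlgTensor γ E :=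
  TensorProduct.map (Adjointable.toCLM T : E →ₗ[ℂ] E) (LinearMap.id : Corr γ →ₗ[ℂ] Corr γ)

@[simp]
theorem AlgTensor.ampl_tmul (T : Adjointable C(K, ℂ) E) (x : E) (f : Corr γ) :
    AlgTensor.ampl T (AlgTensor.tmul x f) = AlgTensor.tmul (T x) f := rfl

theorem AlgTensor.slice_ampl (T : Adjointable C(K, ℂ) E) (j : Fin N) (y : K)
    (t : AlgTensor γ E) : slice j y (ampl T t) = T (slice j y t) := by
  induction t using induction with
  | h0 => simp
  | ha s₁ s₂ h₁ h₂ => simp [h₁, h₂]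
  | ht x f => simp

theorem AlgTensor.norm_ampl_le (T : Adjointable C(K, ℂ) E) (t : AlgTensor γ E) :
    ‖ampl T t‖ ≤ ‖T‖ * ‖t‖ := by
  rw [norm_def, norm_def]
  refine Real.sqrt_le_iff.2 ⟨by positivity, ?_⟩
  rw [mul_pow, Real.sq_sqrt (norm_nonneg _)]
  refine (ContinuousMap.norm_le _ (by positivity)).2 fun y => ?_
  have hr : ∀ s : AlgTensor γ E, form s s y = ((form s s y).re : ℂ) := fun s => by
    have := (Complex.le_def.1 (form_self_nonneg s y)).2
    exact Complex.ext rfl (by simpa using this.symm)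
  have hn : ‖form (ampl T t) (ampl T t) y‖ = (form (ampl T t) (ampl T t) y).re := by
    rw [hr, Complex.norm_real, Complex.ofReal_re]
    exact Real.norm_of_nonneg (Complex.le_def.1 (form_self_nonneg (ampl T t) y)).1
  have h1 : (form (ampl T t) (ampl T t) y).re ≤ ‖T‖ ^ 2 * (form t t y).re := by
    rw [form_apply, form_apply, Complex.re_sum, Complex.re_sum, Finset.mul_sum]
    refine Finset.sum_le_sum fun j _ => ?_
    rw [slice_ampl]
    exact T.inner_apply_apply_le _ _
  rw [hn]
  refine h1.trans ?_
  gcongr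
  exact (Complex.re_le_norm _).trans (ContinuousMap.norm_coe_le_norm _ _)

namespace InteriorTensor

/-- The bounded operator `T ⊗ I` on the interior tensor product. -/
def amplCLM (T : Adjointable C(K, ℂ) E) : InteriorTensor γ E →L[ℂ] InteriorTensor γ E :=
  (ofAlg.comp ((AlgTensor.ampl T).mkContinuous ‖T‖ (AlgTensor.norm_ampl_le T))).extend ofAlg

@[simp]
theorem amplCLM_ofAlg (T : Adjointable C(K, ℂ) E) (t : AlgTensor γ E) :
    amplCLM T (ofAlg t) = ofAlg (AlgTensor.ampl T t) :=
  ContinuousLinearMap.extend_eq _ denseRange_ofAlg isUniformInducing_ofAlg t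

@[simp]
theorem amplCLM_tmul (T : Adjointable C(K, ℂ) E) (x : E) (f : Corr γ) :
    amplCLM T (tmul x f) = tmul (T x) f := by
  rw [tmul, amplCLM_ofAlg, AlgTensor.ampl_tmul, tmul]

theorem zero_tmul (f : Corr γ) : tmul (0 : E) f = 0 := by
  rw [tmul, AlgTensor.tmul, TensorProduct.zero_tmul]; exact map_zero _

theorem add_tmul (x y : E) (f : Corr γ) : tmul (x + y) f = tmul x f + tmul y f := by
  rw [tmul, AlgTensor.tmul, TensorProduct.add_tmul]; exact map_add _ _ _

theorem smul_tmul (c : ℂ) (x : E) (f : Corr γ) : tmul (c • x) f = c • tmul x f := by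
  rw [tmul, AlgTensor.tmul, ← TensorProduct.smul_tmul']; exact map_smul _ _ _

theorem norm_amplCLM_le (T : Adjointable C(K, ℂ) E) :
    ‖amplCLM (γ := γ) T‖ ≤ ‖T‖ := by
  refine ContinuousLinearMap.opNorm_le_bound _ (norm_nonneg _) fun x => ?_
  refine denseRange_ofAlg.induction_on x
    (isClosed_le (amplCLM T).continuous.norm (continuous_const.mul continuous_norm)) fun t => ?_
  rw [amplCLM_ofAlg, norm_ofAlg, norm_ofAlg]
  exact AlgTensor.norm_ampl_le T t

theorem inner_amplCLM (T : Adjointable C(K, ℂ) E) (x y : InteriorTensor γ E) :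
    inner C(K, ℂ) (amplCLM T x) y = inner C(K, ℂ) x (amplCLM (star T) y) := by
  refine denseRange_ofAlg.induction_on₂ ?_ ?_ x y
  · exact isClosed_eq
      (continuous_inner_comp ((amplCLM T).continuous.comp continuous_fst) continuous_snd)
      (continuous_inner_comp continuous_fst ((amplCLM (star T)).continuous.comp continuous_snd))
  · intro s t
    rw [amplCLM_ofAlg, amplCLM_ofAlg, inner_ofAlg, inner_ofAlg]
    ext z
    rw [AlgTensor.form_apply, AlgTensor.form_apply]
    refine Finset.sum_congr rfl fun j _ => ?_
    rw [AlgTensor.slice_ampl, AlgTensor.slice_ampl, Adjointable.inner_star_right]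

theorem clm_ext {F : Type*} [NormedAddCommGroup F] [NormedSpace ℂ F]
    {S T : InteriorTensor γ E →L[ℂ] F}
    (h : ∀ x f, S (tmul x f) = T (tmul x f)) : S = T := by
  refine ContinuousLinearMap.ext fun x => ?_
  refine denseRange_ofAlg.induction_on x (isClosed_eq S.continuous T.continuous) fun t => ?_
  induction t using AlgTensor.induction with
  | h0 => simp
  | ha s₁ s₂ h₁ h₂ => simp [h₁, h₂]
  | ht x f => exact h x f

variable (γ E)

/-- The *-homomorphism `T ↦ T ⊗ I` from `L(E)` to `L(E ⊗ X_γ)`. -/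
def ampl : Adjointable C(K, ℂ) E →⋆ₐ[ℂ] Adjointable C(K, ℂ) (InteriorTensor γ E) where
  toFun T := Adjointable.mk (amplCLM T) (amplCLM (star T)) (inner_amplCLM T)
  map_one' := Adjointable.toCLM_injective <| clm_ext fun x f => by simp
  map_mul' S T := Adjointable.toCLM_injective <| clm_ext fun x f => by simp
  map_zero' := Adjointable.toCLM_injective <| clm_ext fun x f => by
    simp [zero_tmul]
  map_add' S T := Adjointable.toCLM_injective <| clm_ext fun x f => by
    simp [add_tmul]
  commutes' c := Adjointable.toCLM_injective <| clm_ext fun x f => by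
    simp [Algebra.algebraMap_eq_smul_one, smul_tmul]
  map_star' T := Adjointable.ext_inner fun x y => by
    rw [Adjointable.inner_star_right, Adjointable.toCLM_mk, Adjointable.toCLM_mk,
      inner_amplCLM]

variable {γ E}

@[simp]
theorem ampl_tmul (T : Adjointable C(K, ℂ) E) (x : E) (f : Corr γ) :
    ampl γ E T (tmul x f) = tmul (T x) f := amplCLM_tmul T x f

theorem norm_ampl_le (T : Adjointable C(K, ℂ) E) : ‖ampl γ E T‖ ≤ ‖T‖ := norm_amplCLM_le T

end InteriorTensor

end Amplification

/-! ### The tensor powers of `X_γ` and the finite cores -/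

/-- A bundled Hilbert `C(K)`-module. -/
structure HilbertModule (K : Type u) [MetricSpace K] [CompactSpace K] : Type (u + 1) where
  carrier : Type u
  [normedAddCommGroup : NormedAddCommGroup carrier]
  [normedSpace : NormedSpace ℂ carrier]
  [completeSpace : CompleteSpace carrier]
  [module : Module C(K, ℂ) carrier]
  [cstarModule : CStarModule C(K, ℂ) carrier]

attribute [instance] HilbertModule.normedAddCommGroup HilbertModule.normedSpace
  HilbertModule.completeSpace HilbertModule.module HilbertModule.cstarModule

section Core

variable {K : Type u} [MetricSpace K] [CompactSpace K] {N : ℕ} (γ : Fin N → C(K, K))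

/-- The Hilbert `C(K)`-module `X_γ^{⊗ n}`, with `X_γ^{⊗ 0} = C(K)` and
`X_γ^{⊗ (n + 1)} = X_γ^{⊗ n} ⊗_{C(K)} X_γ`. -/
def tensorPower : ℕ → HilbertModule K
  | 0 => ⟨C(K, ℂ)⟩
  | n + 1 => ⟨InteriorTensor γ (tensorPower n).carrier⟩

/-- The underlying space of `X_γ^{⊗ n}`. -/
abbrev XPow (n : ℕ) : Type u := (tensorPower γ n).carrier

/-- The elementary tensor `x ⊗ f ∈ X_γ^{⊗ (n + 1)}` of `x ∈ X_γ^{⊗ n}` and `f ∈ X_γ`. -/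
def XPow.tmul {n : ℕ} (x : XPow γ n) (f : Corr γ) : XPow γ (n + 1) :=
  InteriorTensor.tmul (E := XPow γ n) x f

/-- The algebra `L(X_γ^{⊗ n})`. -/
abbrev LPow (n : ℕ) : Type u := Adjointable C(K, ℂ) (XPow γ n)

/-- The algebra `𝒦(X_γ^{⊗ n})`. -/
abbrev KPow (n : ℕ) : NonUnitalStarSubalgebra ℂ (LPow γ n) :=
  Adjointable.compacts C(K, ℂ) (XPow γ n)

/-- The *-homomorphism `T ↦ T ⊗ I` from `L(X_γ^{⊗ n})` to `L(X_γ^{⊗ (n + 1)})`. -/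
def amplify (n : ℕ) : LPow γ n →⋆ₐ[ℂ] LPow γ (n + 1) := InteriorTensor.ampl γ (XPow γ n)

theorem norm_amplify_le (n : ℕ) (T : LPow γ n) : ‖amplify γ n T‖ ≤ ‖T‖ :=
  InteriorTensor.norm_ampl_le T

/-- The *-homomorphism `T ↦ T ⊗ I_{n - r}` from `L(X_γ^{⊗ r})` to `L(X_γ^{⊗ n})`. -/
def amplifyTo {r n : ℕ} (h : r ≤ n) : LPow γ r →⋆ₐ[ℂ] LPow γ n :=
  Nat.leRecOn (C := fun m => LPow γ r →⋆ₐ[ℂ] LPow γ m) h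
    (fun {m} f => (amplify γ m).comp f) (StarAlgHom.id ℂ _)

theorem amplifyTo_self (n : ℕ) (T : LPow γ n) : amplifyTo γ le_rfl T = T := by
  rw [amplifyTo, Nat.leRecOn_self]; rfl

theorem amplifyTo_succ {r n : ℕ} (h : r ≤ n) (T : LPow γ r) :
    amplifyTo γ (h.trans n.le_succ) T = amplify γ n (amplifyTo γ h T) := by
  rw [amplifyTo, Nat.leRecOn_succ h]; rfl

theorem amplifyTo_trans {r s n : ℕ} (h : r ≤ s) (h' : s ≤ n) (T : LPow γ r) :
    amplifyTo γ h' (amplifyTo γ h T) = amplifyTo γ (h.trans h') T := by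
  induction n, h' using Nat.le_induction with
  | base => rw [amplifyTo_self]
  | succ n h' ih => rw [amplifyTo_succ γ h', amplifyTo_succ γ (h.trans h'), ih]

/-- The linear space `C(K) ⊗ I + 𝒦(X_γ) ⊗ I + ⋯ + 𝒦(X_γ^{⊗ n}) ⊆ L(X_γ^{⊗ n})`
(here `𝒦(X_γ^{⊗ 0}) = 𝒦(C(K)) = C(K)`). -/
def finiteCoreSubmodule (n : ℕ) : Submodule ℂ (LPow γ n) where
  carrier := {T | ∃ t : ∀ r : Fin (n + 1), KPow γ r,
    T = ∑ r : Fin (n + 1), amplifyTo γ (Nat.le_of_lt_succ r.2) (t r : LPow γ r)}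
  zero_mem' := ⟨fun _ => 0, by simp⟩
  add_mem' := by
    rintro _ _ ⟨s, rfl⟩ ⟨t, rfl⟩
    exact ⟨fun r => s r + t r, by simp [Finset.sum_add_distrib]⟩
  smul_mem' := by
    rintro c _ ⟨s, rfl⟩
    exact ⟨fun r => c • s r, by simp [Finset.smul_sum]⟩

theorem amplifyTo_mem {r n : ℕ} (h : r ≤ n) {T : LPow γ r} (hT : T ∈ KPow γ r) :
    amplifyTo γ h T ∈ finiteCoreSubmodule γ n := by
  classical
  let i : Fin (n + 1) := ⟨r, Nat.lt_succ_of_le h⟩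
  refine ⟨Pi.single (M := fun r : Fin (n + 1) => KPow γ r) i ⟨T, hT⟩, ?_⟩
  rw [Finset.sum_eq_single i]
  · rw [Pi.single_eq_same]
  · intro j _ hj
    rw [Pi.single_eq_of_ne hj]
    exact map_zero _
  · simp

theorem amplifyTo_mul_mem {r s n : ℕ} (hr : r ≤ n) (hs : s ≤ n) {S : LPow γ r} {T : LPow γ s}
    (hS : S ∈ KPow γ r) (hT : T ∈ KPow γ s) :
    amplifyTo γ hr S * amplifyTo γ hs T ∈ finiteCoreSubmodule γ n := by
  rcases le_total r s with h | h
  · rw [← amplifyTo_trans γ h hs, ← map_mul]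
    exact amplifyTo_mem γ hs (Adjointable.mul_mem_compacts _ hT)
  · rw [← amplifyTo_trans γ h hr, ← map_mul]
    exact amplifyTo_mem γ hr (Adjointable.mem_compacts_mul _ hS)

theorem one_mem_KPow_zero : (1 : LPow γ 0) ∈ KPow γ 0 := by
  have h : (1 : LPow γ 0) =
      Adjointable.rankOne (A := C(K, ℂ)) (1 : C(K, ℂ)) (1 : C(K, ℂ)) := by
    refine Adjointable.toCLM_injective (ContinuousLinearMap.ext fun (x : C(K, ℂ)) => ?_)
    change x = (x * star (1 : C(K, ℂ))) * 1
    simp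
  rw [h]
  exact Adjointable.rankOne_mem _ _

/-- The finite core
`ℱ^{(n)} = C(K) ⊗ I + 𝒦(X_γ) ⊗ I + ⋯ + 𝒦(X_γ^{⊗ n}) ⊆ L(X_γ^{⊗ n})`. -/
def finiteCore (n : ℕ) : StarSubalgebra ℂ (LPow γ n) where
  carrier := {T | ∃ t : ∀ r : Fin (n + 1), KPow γ r,
    T = ∑ r : Fin (n + 1), amplifyTo γ (Nat.le_of_lt_succ r.2) (t r : LPow γ r)}
  add_mem' := (finiteCoreSubmodule γ n).add_mem
  mul_mem' := by
    rintro _ _ ⟨s, rfl⟩ ⟨t, rfl⟩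
    rw [Finset.sum_mul_sum]
    exact Submodule.sum_mem (finiteCoreSubmodule γ n) fun i _ =>
      Submodule.sum_mem _ fun j _ => amplifyTo_mul_mem γ _ _ (s i).2 (t j).2
  algebraMap_mem' c := by
    have h : (1 : LPow γ n) ∈ finiteCoreSubmodule γ n := by
      rw [← map_one (amplifyTo γ (Nat.zero_le n))]
      exact amplifyTo_mem γ _ (one_mem_KPow_zero γ)
    rw [Algebra.algebraMap_eq_smul_one]
    exact (finiteCoreSubmodule γ n).smul_mem c h
  star_mem' := by
    rintro _ ⟨s, rfl⟩
    exact ⟨fun r => star (s r), by simp [map_star]⟩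

/-- The element `∑_{r ≤ n} T_r ⊗ I_{n - r}` of `ℱ^{(n)}`, for `T_r ∈ 𝒦(X_γ^{⊗ r})`. -/
def finiteCore.sum {n : ℕ} (t : ∀ r : Fin (n + 1), KPow γ r) : finiteCore γ n :=
  ⟨∑ r : Fin (n + 1), amplifyTo γ (Nat.le_of_lt_succ r.2) (t r : LPow γ r), t, rfl⟩

theorem amplify_mem {n : ℕ} {T : LPow γ n} (hT : T ∈ finiteCore γ n) :
    amplify γ n T ∈ finiteCore γ (n + 1) := by
  obtain ⟨t, rfl⟩ := hT
  rw [map_sum]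
  refine Submodule.sum_mem (finiteCoreSubmodule γ (n + 1)) fun r _ => ?_
  rw [← amplifyTo_succ]
  exact amplifyTo_mem γ _ (t r).2

/-- The embedding `ℱ^{(n)} → ℱ^{(n + 1)}`, `T ↦ T ⊗ I`. -/
def coreEmb (n : ℕ) : finiteCore γ n →⋆ₐ[ℂ] finiteCore γ (n + 1) :=
  ((amplify γ n).comp (finiteCore γ n).subtype).codRestrict (finiteCore γ (n + 1))
    fun T => amplify_mem γ T.2

theorem coe_coreEmb (n : ℕ) (T : finiteCore γ n) :
    (coreEmb γ n T : LPow γ (n + 1)) = amplify γ n (T : LPow γ n) := rfl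

theorem norm_coreEmb_le (n : ℕ) (T : finiteCore γ n) : ‖coreEmb γ n T‖ ≤ ‖T‖ :=
  norm_amplify_le γ n T

end Core

/-! ### Matrix algebras and the coordinates of `X_γ^{⊗ n}` in `C(K)^{N^n}` -/

section Matrices

variable {K : Type u} [MetricSpace K] [CompactSpace K] {N : ℕ}

/-- The set `Σ^n` of words of length `n`. -/
abbrev Word (N n : ℕ) : Type := Fin n → Fin N

variable (K N) in
/-- The C*-algebra `M_{N^n}(C(K))`; rows and columns are indexed by words of length `n`. -/
abbrev MatAlg (n : ℕ) : Type u := CStarMatrix (Word N n) (Word N n) C(K, ℂ)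

/-- The first `r` letters of a word of length `n`. -/
def Word.head {r n : ℕ} (h : r ≤ n) (w : Word N n) : Word N r := fun i => w (Fin.castLE h i)

/-- The last `n - r` letters of a word of length `n`. -/
def Word.tail {r n : ℕ} (h : r ≤ n) (w : Word N n) : Word N (n - r) :=
  fun i => w ⟨r + i, by omega⟩

variable (γ : Fin N → C(K, K))

/-- The block-diagonal matrix `diag (α_v(T))_{v ∈ Σ^{n - r}}` in `M_{N^n}(C(K))`, where `α_v(T)` is
obtained from `T ∈ M_{N^r}(C(K))` by composing each entry with `γ_v`. The block of
an index `w ∈ Σ^n` is given by the last `n - r` letters of `w`. -/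
def blockDiag {r n : ℕ} (h : r ≤ n) (T : MatAlg K N r) : MatAlg K N n :=
  CStarMatrix.ofMatrix fun w w' =>
    if w.tail h = w'.tail h then
      (T (w.head h) (w'.head h)).comp (wordMap γ (n - r) (w.tail h))
    else 0

theorem blockDiag_apply {r n : ℕ} (h : r ≤ n) (T : MatAlg K N r) (w w' : Word N n) :
    blockDiag γ h T w w' = if w.tail h = w'.tail h then
      (T (w.head h) (w'.head h)).comp (wordMap γ (n - r) (w.tail h)) else 0 := rfl

/-- The block-diagonal matrix `diag (α_j(T))_{j ∈ Σ}`; the block is given by the last letter. -/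
def matEmbFun (n : ℕ) (T : MatAlg K N n) : MatAlg K N (n + 1) :=
  CStarMatrix.ofMatrix fun w w' =>
    if w (Fin.last n) = w' (Fin.last n) then
      (T (Fin.init w) (Fin.init w')).comp (γ (w (Fin.last n)))
    else 0

theorem matEmbFun_apply {n : ℕ} (T : MatAlg K N n) (w w' : Word N (n + 1)) :
    matEmbFun γ n T w w' =
      if w (Fin.last n) = w' (Fin.last n) then
        (T (Fin.init w) (Fin.init w')).comp (γ (w (Fin.last n)))
      else 0 := rfl

theorem matEmbFun_algebraMap (n : ℕ) (c : ℂ) :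
    matEmbFun γ n (algebraMap ℂ (MatAlg K N n) c) = algebraMap ℂ (MatAlg K N (n + 1)) c := by
  ext w w' y
  have hw : w = w' ↔ w (Fin.last n) = w' (Fin.last n) ∧
      (Fin.init w : Word N n) = Fin.init w' := by
    refine ⟨by rintro rfl; simp, fun ⟨h1, h2⟩ => ?_⟩
    rw [← Fin.snoc_init_self w, ← Fin.snoc_init_self w', h1, h2]
  rw [matEmbFun_apply, Algebra.algebraMap_eq_smul_one, Algebra.algebraMap_eq_smul_one,
    CStarMatrix.smul_apply, CStarMatrix.smul_apply, CStarMatrix.one_apply, CStarMatrix.one_apply]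
  by_cases h1 : w (Fin.last n) = w' (Fin.last n) <;>
    by_cases h2 : (Fin.init w : Word N n) = Fin.init w' <;> simp [hw, h1, h2]

/-- The embedding `M_{N^n}(C(K)) → M_{N^{n+1}}(C(K))`, `T ↦ diag (α_j(T))_{j ∈ Σ}`. -/
def matEmb (n : ℕ) : MatAlg K N n →⋆ₐ[ℂ] MatAlg K N (n + 1) where
  toFun := matEmbFun γ n
  map_one' := by simpa using matEmbFun_algebraMap γ n 1
  map_mul' S T := by
    ext w w' y
    rw [CStarMatrix.mul_apply, ← (Fin.snocEquiv fun _ => Fin N).sum_comp, Fintype.sum_prod_type]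
    by_cases h1 : w (Fin.last n) = w' (Fin.last n)
    · simp [matEmbFun_apply, Fin.snocEquiv, h1, CStarMatrix.mul_apply, Fin.init_snoc]
    · simp [matEmbFun_apply, Fin.snocEquiv, h1]
  map_zero' := by simpa using matEmbFun_algebraMap γ n 0
  map_add' S T := by
    ext w w' y
    by_cases h1 : w (Fin.last n) = w' (Fin.last n) <;> simp [matEmbFun_apply, h1]
  commutes' := matEmbFun_algebraMap γ n
  map_star' T := by
    ext w w' y
    by_cases h1 : w (Fin.last n) = w' (Fin.last n)
    · simp [matEmbFun_apply, CStarMatrix.star_apply, h1]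
    · simp [matEmbFun_apply, CStarMatrix.star_apply, h1, Ne.symm h1]

theorem matEmb_apply {n : ℕ} (T : MatAlg K N n) (w w' : Word N (n + 1)) :
    matEmb γ n T w w' =
      if w (Fin.last n) = w' (Fin.last n) then
        (T (Fin.init w) (Fin.init w')).comp (γ (w (Fin.last n)))
      else 0 := rfl

theorem norm_matEmb_le (n : ℕ) (T : MatAlg K N n) : ‖matEmb γ n T‖ ≤ ‖T‖ :=
  NonUnitalStarAlgHom.norm_apply_le (matEmb γ n) T

theorem wordMap_congr {k k' : ℕ} (e : k = k') (w : Word N k) :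
    wordMap γ k w = wordMap γ k' (fun i => w (Fin.cast e.symm i)) := by
  subst e; rfl

theorem blockDiag_self {n : ℕ} (T : MatAlg K N n) : blockDiag γ le_rfl T = T := by
  ext w w' y
  have hk : n - n = 0 := Nat.sub_self n
  have hw : ∀ v : Word N n, v.head le_rfl = v := fun v => rfl
  have ht : w.tail le_rfl = w'.tail le_rfl := funext fun i => absurd i.2 (by omega)
  rw [blockDiag_apply, if_pos ht, hw, hw, wordMap_congr γ hk]
  rfl

theorem blockDiag_succ {r n : ℕ} (h : r ≤ n) (T : MatAlg K N r) :
    blockDiag γ (h.trans n.le_succ) T = matEmb γ n (blockDiag γ h T) := by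
  ext w w' y
  have hk : n + 1 - r = n - r + 1 := Nat.succ_sub h
  have hh : ∀ v : Word N (n + 1),
      v.head (h.trans n.le_succ) = Word.head h (Fin.init v) := fun v => rfl
  have hlast : ∀ v : Word N (n + 1),
      (v.tail (h.trans n.le_succ)) ⟨n - r, by omega⟩ = v (Fin.last n) := fun v => by
    simp only [Word.tail]; congr 1; ext; simp; omega
  have ht : ∀ v v' : Word N (n + 1),
      v.tail (h.trans n.le_succ) = v'.tail (h.trans n.le_succ) ↔
        v (Fin.last n) = v' (Fin.last n) ∧
          Word.tail h (Fin.init v) = Word.tail h (Fin.init v') := fun v v' => by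
    constructor
    · intro e
      refine ⟨by rw [← hlast v, ← hlast v', e], funext fun i => ?_⟩
      exact congrFun e ⟨i, by omega⟩
    · rintro ⟨e1, e2⟩
      funext i
      by_cases hi : (i : ℕ) < n - r
      · exact congrFun e2 ⟨i, hi⟩
      · have : i = ⟨n - r, by omega⟩ := Fin.ext (by have := i.2; simp; omega)
        rw [this, hlast, hlast, e1]
  have hmap : wordMap γ (n + 1 - r) (w.tail (h.trans n.le_succ)) =
      (wordMap γ (n - r) (Word.tail h (Fin.init w))).comp (γ (w (Fin.last n))) := by
    rw [wordMap_congr γ hk, wordMap, ← hlast w]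
    rfl
  rw [matEmb_apply, blockDiag_apply, blockDiag_apply, hmap, hh, hh]
  simp only [ht]
  by_cases h1 : w (Fin.last n) = w' (Fin.last n) <;>
    by_cases h2 : Word.tail h (Fin.init w) = Word.tail h (Fin.init w') <;> simp [h1, h2]

variable {γ}

/-- The matrix `[f_i \bar g_j]_{ij}` of the rank-one operator `θ_{f,g} : z ↦ f ⟨g, z⟩` on the free
Hilbert module `C(K)^{N^n}`. -/
def matRankOne {n : ℕ} (f g : Word N n → C(K, ℂ)) : MatAlg K N n :=
  CStarMatrix.ofMatrix fun w w' => f w * star (g w')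

/-- The action of a matrix on the free Hilbert module `C(K)^{N^n}` of column vectors. -/
def matAct {n : ℕ} (T : MatAlg K N n) (f : Word N n → C(K, ℂ)) : Word N n → C(K, ℂ) :=
  fun w => ∑ w', T w w' * f w'

theorem matRankOne_apply {n : ℕ} (f g : Word N n → C(K, ℂ)) (w w' : Word N n) :
    matRankOne f g w w' = f w * star (g w') := rfl

theorem matAct_matRankOne {n : ℕ} (f g z : Word N n → C(K, ℂ)) :
    matAct (matRankOne f g) z = fun w => f w * ∑ w', star (g w') * z w' := by
  ext w y
  simp [matAct, matRankOne_apply, Finset.mul_sum, mul_assoc]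

section CoordinateStep

variable {E : Type u} [NormedAddCommGroup E] [NormedSpace ℂ E] [Module C(K, ℂ) E]
  [CStarModule C(K, ℂ) E] {n : ℕ}

/-- From coordinates `ζ : E → C(K)^{N^n}`, the coordinates
`(x ⊗ f)_{(w, j)}(y) = ζ(x)_w(γ_j(y)) f(γ_j(y), y)` on the algebraic tensor product. -/
def algCoord (ζ : E →L[ℂ] (Word N n → C(K, ℂ))) :
    AlgTensor γ E →ₗ[ℂ] (Word N (n + 1) → C(K, ℂ)) :=
  TensorProduct.lift <| LinearMap.mk₂ ℂ
    (fun x f w => (ζ x (Fin.init w)).comp (γ (w (Fin.last n))) *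
      f.comp (cographMap γ (w (Fin.last n))))
    (fun x x' f => by ext w y; simp [add_mul])
    (fun c x f => by ext w y; simp)
    (fun x f f' => by ext w y; simp [mul_add])
    (fun c x f => by ext w y; simp)

theorem algCoord_tmul (ζ : E →L[ℂ] (Word N n → C(K, ℂ))) (x : E) (f : Corr γ)
    (w : Word N (n + 1)) (y : K) :
    algCoord ζ (AlgTensor.tmul x f) w y =
      ζ x (Fin.init w) (γ (w (Fin.last n)) y) * f (cographMap γ (w (Fin.last n)) y) := rfl

theorem algCoord_apply (ζ : E →L[ℂ] (Word N n → C(K, ℂ))) (t : AlgTensor γ E)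
    (w : Word N (n + 1)) (y : K) :
    algCoord ζ t w y =
      ζ (AlgTensor.slice (w (Fin.last n)) y t) (Fin.init w) (γ (w (Fin.last n)) y) := by
  induction t using AlgTensor.induction with
  | h0 => simp
  | ha s t hs ht => simp [hs, ht]
  | ht x f => rw [algCoord_tmul]; simp [mul_comm]

theorem sum_algCoord {ζ : E →L[ℂ] (Word N n → C(K, ℂ))}
    (hζ : ∀ x x', ∑ w, star (ζ x w) * ζ x' w = inner C(K, ℂ) x x') (s t : AlgTensor γ E) :
    ∑ w, star (algCoord ζ s w) * algCoord ζ t w = AlgTensor.form s t := by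
  ext y
  rw [← (Fin.snocEquiv fun _ => Fin N).sum_comp, Fintype.sum_prod_type, AlgTensor.form_apply,
    ContinuousMap.sum_apply]
  refine Finset.sum_congr rfl fun j _ => ?_
  rw [← hζ, ContinuousMap.sum_apply, ContinuousMap.sum_apply]
  refine Finset.sum_congr rfl fun w _ => ?_
  simp [algCoord_apply, Fin.snocEquiv]

theorem norm_algCoord_le {ζ : E →L[ℂ] (Word N n → C(K, ℂ))}
    (hζ : ∀ x x', ∑ w, star (ζ x w) * ζ x' w = inner C(K, ℂ) x x') (t : AlgTensor γ E) :
    ‖algCoord ζ t‖ ≤ 1 * ‖t‖ := by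
  rw [one_mul, AlgTensor.norm_def]
  refine (pi_norm_le_iff_of_nonneg (Real.sqrt_nonneg _)).2 fun w =>
    (ContinuousMap.norm_le _ (Real.sqrt_nonneg _)).2 fun y => Real.le_sqrt_of_sq_le ?_
  have h := congrArg (fun g : C(K, ℂ) => (g y).re) (sum_algCoord hζ t t)
  simp only [ContinuousMap.sum_apply, ContinuousMap.mul_apply, ContinuousMap.star_apply,
    Complex.re_sum] at h
  have hsq : ∀ z : ℂ, (star z * z).re = ‖z‖ ^ 2 := fun z => by
    rw [RCLike.star_def, Complex.conj_mul']; norm_cast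
  simp only [hsq] at h
  calc ‖algCoord ζ t w y‖ ^ 2 ≤ ∑ w, ‖algCoord ζ t w y‖ ^ 2 :=
        Finset.single_le_sum (f := fun w => ‖algCoord ζ t w y‖ ^ 2)
          (fun w _ => by positivity) (Finset.mem_univ w)
    _ = (AlgTensor.form t t y).re := h
    _ ≤ _ := (Complex.re_le_norm _).trans (ContinuousMap.norm_coe_le_norm _ _)

/-- The coordinates on the interior tensor product. -/
def tensorCoord (ζ : E →L[ℂ] (Word N n → C(K, ℂ)))
    (hζ : ∀ x x', ∑ w, star (ζ x w) * ζ x' w = inner C(K, ℂ) x x') :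
    InteriorTensor γ E →L[ℂ] (Word N (n + 1) → C(K, ℂ)) :=
  ((algCoord ζ).mkContinuous 1 (norm_algCoord_le hζ)).extend InteriorTensor.ofAlg

theorem tensorCoord_ofAlg (ζ : E →L[ℂ] (Word N n → C(K, ℂ)))
    (hζ : ∀ x x', ∑ w, star (ζ x w) * ζ x' w = inner C(K, ℂ) x x') (t : AlgTensor γ E) :
    tensorCoord ζ hζ (InteriorTensor.ofAlg t) = algCoord ζ t :=
  ContinuousLinearMap.extend_eq _ InteriorTensor.denseRange_ofAlg
    InteriorTensor.isUniformInducing_ofAlg t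

theorem sum_tensorCoord (ζ : E →L[ℂ] (Word N n → C(K, ℂ)))
    (hζ : ∀ x x', ∑ w, star (ζ x w) * ζ x' w = inner C(K, ℂ) x x') (s t : InteriorTensor γ E) :
    ∑ w, star (tensorCoord ζ hζ s w) * tensorCoord ζ hζ t w = inner C(K, ℂ) s t := by
  refine InteriorTensor.denseRange_ofAlg.induction_on₂ ?_ ?_ s t
  · have h1 : ∀ w, Continuous fun p : InteriorTensor γ E × InteriorTensor γ E =>
        tensorCoord ζ hζ p.1 w := fun w =>
      (continuous_apply w).comp ((tensorCoord ζ hζ).continuous.comp continuous_fst)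
    have h2 : ∀ w, Continuous fun p : InteriorTensor γ E × InteriorTensor γ E =>
        tensorCoord ζ hζ p.2 w := fun w =>
      (continuous_apply w).comp ((tensorCoord ζ hζ).continuous.comp continuous_snd)
    exact isClosed_eq
      (continuous_finsetSum _ fun w _ => (continuous_star.comp (h1 w)).mul (h2 w))
      (InteriorTensor.continuous_inner_comp continuous_fst continuous_snd)
  · intro s t
    rw [tensorCoord_ofAlg, tensorCoord_ofAlg, InteriorTensor.inner_ofAlg, sum_algCoord hζ]

end CoordinateStep

variable (γ)

/-- The coordinates on `X_γ^{⊗ n}`, together with the fact that they preserve inner products. -/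
def coordData : ∀ n : ℕ, {ζ : XPow γ n →L[ℂ] (Word N n → C(K, ℂ)) //
    ∀ x x', ∑ w, star (ζ x w) * ζ x' w = inner C(K, ℂ) x x'}
  | 0 => ⟨ContinuousLinearMap.pi fun _ => ContinuousLinearMap.id ℂ C(K, ℂ),
      fun (x x' : C(K, ℂ)) => by
        rw [Fintype.sum_unique]
        exact mul_comm (star x) x'⟩
  | n + 1 => ⟨tensorCoord (coordData n).1 (coordData n).2,
      sum_tensorCoord (coordData n).1 (coordData n).2⟩

/-- The embedding of `X_γ^{⊗ n}` into the free module `Y_γ^{⊗ n} = C(K)^{N^n}`, through which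
`X_γ^{⊗ n}` is identified with `Z_γ^{⊗ n}`. It is given by `a ↦ a` for `n = 0` and recursively by
`(x ⊗ f)_{(w, j)}(y) = x_w(γ_j(y)) f(γ_j(y), y)`. -/
def coord (n : ℕ) : XPow γ n →L[ℂ] (Word N n → C(K, ℂ)) := (coordData γ n).1

theorem coord_zero (a : C(K, ℂ)) (w : Word N 0) : coord γ 0 a w = a := rfl

theorem coord_tmul {n : ℕ} (x : XPow γ n) (f : Corr γ) (w : Word N (n + 1)) (y : K) :
    coord γ (n + 1) (XPow.tmul γ x f) w y =
      coord γ n x (Fin.init w) (γ (w (Fin.last n)) y) *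
        f (cographMap γ (w (Fin.last n)) y) := by
  change tensorCoord (coordData γ n).1 (coordData γ n).2
    (InteriorTensor.ofAlg (AlgTensor.tmul x f)) w y = _
  rw [tensorCoord_ofAlg, algCoord_tmul]
  rfl

theorem sum_coord {n : ℕ} (x x' : XPow γ n) :
    ∑ w, star (coord γ n x w) * coord γ n x' w = inner C(K, ℂ) x x' := (coordData γ n).2 x x'

/-- The subalgebra `D^{γ^n}` of `M_{N^n}(C(K))`: matrices `a` such that, at every point `c`, the rows
of `a(c)` (and also the columns) indexed by words with the same value `γ_w(c)` coincide.
(The condition is void unless that value is a branch point of `γ^n`.) -/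
def matD (n : ℕ) : Set (MatAlg K N n) :=
  {a | ∀ (c : K) (w w' : Word N n), wordMap γ n w c = wordMap γ n w' c →
    ∀ v : Word N n, a w v c = a w' v c ∧ a v w c = a v w' c}

end Matrices

/-! ### Inductive limits of sequences of C*-algebras -/

/-- A sequence `A_0 → A_1 → A_2 → ⋯` of normed *-algebras and contractive *-homomorphisms. -/
structure InductiveSystem : Type (u + 1) where
  alg : ℕ → Type u
  [normedRing : ∀ n, NormedRing (alg n)]
  [normedAlgebra : ∀ n, NormedAlgebra ℂ (alg n)]
  [starRing : ∀ n, StarRing (alg n)]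
  [starModule : ∀ n, StarModule ℂ (alg n)]
  [normedStarGroup : ∀ n, NormedStarGroup (alg n)]
  map : ∀ n, alg n →⋆ₐ[ℂ] alg (n + 1)
  norm_map_le : ∀ n (x : alg n), ‖map n x‖ ≤ ‖x‖

attribute [instance] InductiveSystem.normedRing InductiveSystem.normedAlgebra
  InductiveSystem.starRing InductiveSystem.starModule InductiveSystem.normedStarGroup

namespace InductiveSystem

variable (S : InductiveSystem.{u})

/-- The *-algebra of all sequences `(x_n)`, `x_n ∈ A_n`, with `x_{n + 1} = φ_n(x_n)` for all large
`n`. -/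
def threads : StarSubalgebra ℂ (∀ n, S.alg n) where
  carrier := {x | ∃ m, ∀ n, m ≤ n → x (n + 1) = S.map n (x n)}
  add_mem' := by
    rintro x y ⟨m, hm⟩ ⟨k, hk⟩
    exact ⟨max m k, fun n hn => by
      simp [hm n ((le_max_left _ _).trans hn), hk n ((le_max_right _ _).trans hn)]⟩
  mul_mem' := by
    rintro x y ⟨m, hm⟩ ⟨k, hk⟩
    exact ⟨max m k, fun n hn => by
      simp [hm n ((le_max_left _ _).trans hn), hk n ((le_max_right _ _).trans hn)]⟩
  algebraMap_mem' c := ⟨0, fun n _ => ((S.map n).toAlgHom.commutes c).symm⟩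
  star_mem' := by
    rintro x ⟨m, hm⟩
    exact ⟨m, fun n hn => by simp [hm n hn, map_star]⟩

/-- The *-algebra of threads, with the seminorm `lim ‖x_n‖`. -/
def PreLimit : Type u := S.threads

namespace PreLimit

variable {S}

instance : Ring S.PreLimit := inferInstanceAs (Ring S.threads)
instance : StarRing S.PreLimit := inferInstanceAs (StarRing S.threads)
instance : Algebra ℂ S.PreLimit := inferInstanceAs (Algebra ℂ S.threads)
instance : StarModule ℂ S.PreLimit := inferInstanceAs (StarModule ℂ S.threads)

/-- The `n`-th entry of a thread. -/
def entry (x : S.PreLimit) (n : ℕ) : S.alg n := x.1 n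

/-- The seminorm `lim ‖x_n‖`; the sequence `‖x_n‖` is eventually decreasing. -/
def seminorm (x : S.PreLimit) : ℝ := Filter.limUnder Filter.atTop fun n => ‖x.entry n‖

theorem tendsto_seminorm (x : S.PreLimit) :
    Filter.Tendsto (fun n => ‖x.entry n‖) Filter.atTop (nhds x.seminorm) := by
  obtain ⟨m, hm⟩ := x.2
  have h : Antitone fun n => ‖x.entry (m + n)‖ := antitone_nat_of_succ_le fun n => by
    change ‖x.1 (m + n + 1)‖ ≤ ‖x.1 (m + n)‖
    rw [hm (m + n) (Nat.le_add_right m n)]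
    exact S.norm_map_le _ _
  have h2 := tendsto_atTop_ciInf h ⟨0, by rintro _ ⟨n, rfl⟩; exact norm_nonneg _⟩
  refine tendsto_nhds_limUnder ⟨_, (Filter.tendsto_add_atTop_iff_nat m).1
    (h2.congr fun n => ?_)⟩
  rw [add_comm]

instance : SeminormedRing S.PreLimit :=
  RingSeminorm.toSeminormedRing
    { toFun := seminorm
      map_zero' := tendsto_nhds_unique (tendsto_seminorm 0) (by
        simp [show ∀ n, entry (0 : S.PreLimit) n = 0 from fun _ => rfl])
      add_le' := fun x y => le_of_tendsto_of_tendsto' (tendsto_seminorm (x + y))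
        ((tendsto_seminorm x).add (tendsto_seminorm y)) fun n =>
          norm_add_le (x.entry n) (y.entry n)
      neg' := fun x => tendsto_nhds_unique (tendsto_seminorm (-x))
        ((tendsto_seminorm x).congr fun n => (norm_neg (x.entry n)).symm)
      mul_le' := fun x y => le_of_tendsto_of_tendsto' (tendsto_seminorm (x * y))
        ((tendsto_seminorm x).mul (tendsto_seminorm y)) fun n =>
          norm_mul_le (x.entry n) (y.entry n) }

theorem norm_def (x : S.PreLimit) : ‖x‖ = x.seminorm := rfl

theorem tendsto_norm (x : S.PreLimit) :
    Filter.Tendsto (fun n => ‖x.entry n‖) Filter.atTop (nhds ‖x‖) := tendsto_seminorm x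

instance : NormedAlgebra ℂ S.PreLimit where
  norm_smul_le c x := le_of_eq <| tendsto_nhds_unique (tendsto_norm (c • x))
    (((tendsto_norm x).const_mul ‖c‖).congr fun n => (norm_smul c (x.entry n)).symm)

instance : NormedStarGroup S.PreLimit where
  norm_star_le x := le_of_eq <| tendsto_nhds_unique (tendsto_norm (star x))
    ((tendsto_norm x).congr fun n => (norm_star (x.entry n)).symm)

end PreLimit

/-- The inductive limit of the system in the category of C*-algebras: the completion (and separation)
of the *-algebra of threads for the seminorm `lim ‖x_n‖`. -/
def Limit : Type u := UniformSpace.Completion S.PreLimit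

namespace Limit

instance : NormedRing S.Limit := inferInstanceAs (NormedRing (UniformSpace.Completion S.PreLimit))
instance : CompleteSpace S.Limit :=
  inferInstanceAs (CompleteSpace (UniformSpace.Completion S.PreLimit))
instance : Algebra ℂ S.Limit :=
  inferInstanceAs (Algebra ℂ (UniformSpace.Completion S.PreLimit))

variable {S}

/-- The class of a thread. -/
def mk (x : S.PreLimit) : S.Limit := (x : UniformSpace.Completion S.PreLimit)

theorem denseRange_mk : DenseRange (mk (S := S)) := UniformSpace.Completion.denseRange_coe

theorem norm_mk (x : S.PreLimit) : ‖mk x‖ = ‖x‖ := UniformSpace.Completion.norm_coe x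

theorem continuous_mk : Continuous (mk (S := S)) :=
  UniformSpace.Completion.continuous_coe S.PreLimit

theorem mk_add (x y : S.PreLimit) : mk (x + y) = mk x + mk y := UniformSpace.Completion.coe_add x y

theorem mk_mul (x y : S.PreLimit) : mk (x * y) = mk x * mk y := UniformSpace.Completion.coe_mul x y

theorem mk_smul (c : ℂ) (x : S.PreLimit) : mk (c • x) = c • mk x := by
  rw [Algebra.smul_def, Algebra.smul_def, mk_mul]; rfl

instance : NormedAlgebra ℂ S.Limit where
  norm_smul_le c x := by
    refine denseRange_mk.induction_on x (isClosed_le ?_ ?_) fun x => ?_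
    · simp only [Algebra.smul_def]; fun_prop
    · fun_prop
    · rw [← mk_smul, norm_mk, norm_mk, norm_smul]

/-- The involution, extended by continuity. -/
def starFun : S.Limit → S.Limit :=
  UniformSpace.Completion.map (star : S.PreLimit → S.PreLimit)

theorem continuous_starFun : Continuous (starFun (S := S)) := UniformSpace.Completion.continuous_map

theorem starFun_mk (x : S.PreLimit) : starFun (mk x) = mk (star x) :=
  UniformSpace.Completion.map_coe (starₗᵢ ℂ (E := S.PreLimit)).isometry.uniformContinuous x

instance : StarRing S.Limit where
  star := starFun
  star_involutive x := by
    refine denseRange_mk.induction_on x (isClosed_eq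
      (continuous_starFun.comp continuous_starFun) continuous_id) fun x => ?_
    rw [starFun_mk, starFun_mk, star_star]
  star_mul x y := by
    refine denseRange_mk.induction_on₂ (isClosed_eq (continuous_starFun.comp
      (continuous_fst.mul continuous_snd)) ((continuous_starFun.comp continuous_snd).mul
        (continuous_starFun.comp continuous_fst))) (fun x y => ?_) x y
    change starFun (mk x * mk y) = starFun (mk y) * starFun (mk x)
    rw [← mk_mul, starFun_mk, starFun_mk, starFun_mk, star_mul, mk_mul]
  star_add x y := by
    refine denseRange_mk.induction_on₂ (isClosed_eq (continuous_starFun.comp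
      (continuous_fst.add continuous_snd)) ((continuous_starFun.comp continuous_fst).add
        (continuous_starFun.comp continuous_snd))) (fun x y => ?_) x y
    change starFun (mk x + mk y) = starFun (mk x) + starFun (mk y)
    rw [← mk_add, starFun_mk, starFun_mk, starFun_mk, star_add, mk_add]

theorem star_mk (x : S.PreLimit) : star (mk x) = mk (star x) := starFun_mk x

end Limit

variable {S}

/-- The composition `A_n → A_m` of the maps of the system. -/
def mapTo {n m : ℕ} (h : n ≤ m) : S.alg n →⋆ₐ[ℂ] S.alg m :=
  Nat.leRecOn (C := fun m => S.alg n →⋆ₐ[ℂ] S.alg m) h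
    (fun {m} f => (S.map m).comp f) (StarAlgHom.id ℂ _)

theorem mapTo_self (n : ℕ) (x : S.alg n) : mapTo le_rfl x = x := by
  rw [mapTo, Nat.leRecOn_self]; rfl

theorem mapTo_succ {n m : ℕ} (h : n ≤ m) (x : S.alg n) :
    mapTo (h.trans m.le_succ) x = S.map m (mapTo h x) := by
  rw [mapTo, Nat.leRecOn_succ h]; rfl

/-- The thread `(0, …, 0, x, φ_n(x), φ_{n + 1}(φ_n(x)), …)`. -/
def thread (n : ℕ) (x : S.alg n) : S.PreLimit :=
  ⟨fun m => if h : n ≤ m then mapTo h x else 0, n, fun m hm => by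
    simp only [dif_pos hm, dif_pos (hm.trans m.le_succ), mapTo_succ hm]⟩

/-- The canonical map of `A_n` into the inductive limit. -/
def Limit.of (n : ℕ) (x : S.alg n) : S.Limit := Limit.mk (thread n x)

end InductiveSystem

section Limits

variable {K : Type u} [MetricSpace K] [CompactSpace K] {N : ℕ} (γ : Fin N → C(K, K))

instance (n : ℕ) : NormedStarGroup (finiteCore γ n) :=
  ⟨fun T => NormedStarGroup.norm_star_le (T : LPow γ n)⟩

/-- The system `ℱ^{(0)} → ℱ^{(1)} → ⋯` with maps `T ↦ T ⊗ I`. -/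
def coreSystem : InductiveSystem.{u} where
  alg n := finiteCore γ n
  map := coreEmb γ
  norm_map_le := norm_coreEmb_le γ

/-- The core `ℱ^{(∞)}`: the inductive limit of the finite cores. -/
abbrev Core : Type u := (coreSystem γ).Limit

/-- The system `C(K) → M_N(C(K)) → M_{N^2}(C(K)) → ⋯` with maps `T ↦ diag (α_j(T))_j`. -/
def matSystem : InductiveSystem.{u} where
  alg n := MatAlg K N n
  map := matEmb γ
  norm_map_le := norm_matEmb_le γ

/-- The C*-algebra `M_{N^∞}(C(K))`: the inductive limit of the algebras `M_{N^n}(C(K))` along the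
embeddings `T ↦ diag (α_j(T))_j`. -/
abbrev MatInfinity : Type u := (matSystem γ).Limit

/-- The canonical map `ℱ^{(n)} → ℱ^{(∞)}`. -/
def Core.of (n : ℕ) (T : finiteCore γ n) : Core γ :=
  InductiveSystem.Limit.of (S := coreSystem γ) n T

/-- The canonical map `M_{N^n}(C(K)) → M_{N^∞}(C(K))`. -/
def MatInfinity.of (n : ℕ) (T : MatAlg K N n) : MatInfinity γ :=
  InductiveSystem.Limit.of (S := matSystem γ) n T

end Limits

end SelfSimilar

end

noncomputable section

namespace SelfSimilar

universe u

/-! ### Norms of matrices over `C(K)` -/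

section MatrixNorm

variable {K : Type u} [MetricSpace K] [CompactSpace K] {N n : ℕ}

/-! Let `Z` be the image of `X^{⊗n}` in the free module. A matrix `M` over `C(K)` is linked to an
operator `T` on `X^{⊗n}` when `M`, acting on column vectors, restricts to `T` on `Z` (`Represents`).
The theorem rests on one fact: a linked matrix has the same norm as its operator
(`Represents.norm_eq`). Linked pairs are stable under the *-algebra operations, so a matrix linked
to `0` vanishes and `M` is determined by `T` (`Represents.ext`). Hence, wherever `M` exists, `T ↦ M`
is automatically an isometric *-homomorphism, and any two matrix expressions linked to the same
operator agree. This is why the value on `ℱ^{(n)}` does not depend on how an element is written as a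
sum.

Why the norms agree: `‖T‖ ≤ ‖M‖` because the embedding preserves inner products. For the converse,
`Z` may be a proper submodule, since its vectors have coinciding coordinates at points where
branches meet. But for all except finitely many `c` the branches separate at every stage, and there
the values at `c` of elements of `Z` fill all of `ℂ^{Σ^n}` (`exists_coord_eq`). Since `K` has no
isolated points, these `c` are dense (`dense_unbranched`). At such a point the inequality `⟨Tx, Tx⟩
≤ ‖T‖² ⟨x, x⟩` bounds the matrix `M(c)`, and continuity extends the bound to `K`.

Existence: `θ_{x,y}` is linked to `[x_w \bar y_{w'}]` by `Represents.rankOne`; norm equality makes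
matrices linked to a convergent sequence a Cauchy sequence, which gives all compact operators; and
passing from `T` to `T ⊗ I` corresponds to `diag (α_j(M))_j` (`Represents.amplify`). The rows and
columns coincide as `D^{γ^n}` demands because the coordinates already do (`coord_eq_of_wordMap_eq`).
The isometries of the finite stages commute with the connecting maps and so induce an isometry of
the inductive limits. -/

theorem sum_star_mul_self_apply {ι : Type*} [Fintype ι] (f : ι → C(K, ℂ)) (y : K) :
    (∑ w, star (f w) * f w) y = ((∑ w, ‖f w y‖ ^ 2 : ℝ) : ℂ) := by
  rw [ContinuousMap.sum_apply, Complex.ofReal_sum]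
  refine Finset.sum_congr rfl fun w _ => ?_
  rw [ContinuousMap.mul_apply, ContinuousMap.star_apply, RCLike.star_def, Complex.conj_mul']
  norm_cast

theorem norm_sum_star_mul_self_le {ι : Type*} [Fintype ι] (f : ι → C(K, ℂ)) {R : ℝ}
    (hR : 0 ≤ R) :
    ‖∑ w, star (f w) * f w‖ ≤ R ↔ ∀ y, ∑ w, ‖f w y‖ ^ 2 ≤ R := by
  rw [ContinuousMap.norm_le _ hR]
  refine forall_congr' fun y => ?_
  rw [sum_star_mul_self_apply, Complex.norm_real, Real.norm_of_nonneg (by positivity)]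

theorem sqrt_le_iff_of_nonneg {a R : ℝ} (hR : 0 ≤ R) : √a ≤ R ↔ a ≤ R ^ 2 := by
  rw [Real.sqrt_le_iff, and_iff_right hR]

-- The Hilbert module norm is the supremum over `y` of the Euclidean norm of the vector of values at
-- `y`. In this pointwise form it can be compared directly with the norm of `X^{⊗n}` in
-- `norm_XPow_le`.
open WithCStarModule in
theorem norm_freeModule_le (f : Word N n → C(K, ℂ)) {R : ℝ} (hR : 0 ≤ R) :
    ‖(equiv C(K, ℂ) (Word N n → C(K, ℂ))).symm f‖ ≤ R ↔ ∀ y, ∑ w, ‖f w y‖ ^ 2 ≤ R ^ 2 := by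
  rw [pi_norm, sqrt_le_iff_of_nonneg hR, ← norm_sum_star_mul_self_le f (by positivity)]
  simp [inner_def, mul_comm]

/-- `CStarMatrix.toCLM` multiplies row vectors by the matrix from the right, whereas `matAct` acts
on column vectors. Entrywise conjugation together with `star M` passes from one convention to the
other. -/
theorem toCLM_star_apply (M : MatAlg K N n) (f : Word N n → C(K, ℂ)) :
    CStarMatrix.toCLM (star M) ((WithCStarModule.equiv C(K, ℂ) (Word N n → C(K, ℂ))).symm f) =
      (WithCStarModule.equiv _ _).symm (star (matAct M (star f))) := by
  rw [CStarMatrix.toCLM_apply_eq_sum]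
  congr 1
  ext w y
  simp [matAct, CStarMatrix.star_apply, mul_comm]

/-- A matrix is bounded by its norm on vectors. -/
theorem sum_norm_matAct_sq_le (M : MatAlg K N n) (f : Word N n → C(K, ℂ)) {R : ℝ} (hR : 0 ≤ R)
    (hf : ∀ y, ∑ w, ‖f w y‖ ^ 2 ≤ R ^ 2) (y : K) :
    ∑ w, ‖matAct M f w y‖ ^ 2 ≤ (‖M‖ * R) ^ 2 := by
  have h1 : ‖(WithCStarModule.equiv C(K, ℂ) (Word N n → C(K, ℂ))).symm (star f)‖ ≤ R :=
    (norm_freeModule_le _ hR).2 (by simpa using hf)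
  have h2 := (CStarMatrix.toCLM (star M)).le_opNorm
    ((WithCStarModule.equiv C(K, ℂ) (Word N n → C(K, ℂ))).symm (star f))
  -- The norm of a matrix is by definition the operator norm of its `toCLM`, so this says that the
  -- involution is isometric.
  have e : ‖CStarMatrix.toCLM (star M)‖ = ‖M‖ := norm_star M
  rw [toCLM_star_apply, star_star, e] at h2
  have h3 := (norm_freeModule_le _ (by positivity : 0 ≤ ‖M‖ * R)).1
    (h2.trans (by gcongr)) y
  simpa using h3

/-- The norm of a matrix is at most any pointwise bound for its action on vectors. -/
theorem norm_le_of_sum_norm_matAct_sq_le (M : MatAlg K N n) {C : ℝ} (hC : 0 ≤ C)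
    (h : ∀ (f : Word N n → C(K, ℂ)) (y : K),
      ∑ w, ‖matAct M f w y‖ ^ 2 ≤ C ^ 2 * ∑ w, ‖f w y‖ ^ 2) : ‖M‖ ≤ C := by
  rw [← norm_star M, CStarMatrix.norm_def]
  refine ContinuousLinearMap.opNorm_le_bound _ hC fun v => ?_
  obtain ⟨f, rfl⟩ := (WithCStarModule.equiv C(K, ℂ) (Word N n → C(K, ℂ))).symm.surjective v
  rw [toCLM_star_apply, norm_freeModule_le _ (by positivity)]
  intro y
  have h1 := h (star f) y
  have h2 := (norm_freeModule_le f (norm_nonneg _)).1 le_rfl y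
  simp only [Pi.star_apply, ContinuousMap.star_apply, norm_star] at h1 ⊢
  rw [mul_pow]
  exact h1.trans (by gcongr)

/-- The action of a matrix as a continuous linear map. -/
def matActL (M : MatAlg K N n) : (Word N n → C(K, ℂ)) →L[ℂ] (Word N n → C(K, ℂ)) :=
  ContinuousLinearMap.pi fun w => ∑ w', (ContinuousLinearMap.mul ℂ C(K, ℂ) (M w w')).comp
    (ContinuousLinearMap.proj w')

theorem matActL_apply (M : MatAlg K N n) (f : Word N n → C(K, ℂ)) :
    matActL M f = matAct M f := by
  ext w y
  simp [matActL, matAct]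

theorem add_matAct (S T : MatAlg K N n) (f : Word N n → C(K, ℂ)) :
    matAct (S + T) f = matAct S f + matAct T f := by
  ext w y
  simp [matAct, add_mul, Finset.sum_add_distrib]

theorem sub_matAct (S T : MatAlg K N n) (f : Word N n → C(K, ℂ)) :
    matAct (S - T) f = matAct S f - matAct T f := by
  ext w y
  simp [matAct, sub_mul]

theorem smul_matAct (c : ℂ) (T : MatAlg K N n) (f : Word N n → C(K, ℂ)) :
    matAct (c • T) f = c • matAct T f := by
  ext w y
  simp [matAct, Finset.mul_sum]

theorem mul_matAct (S T : MatAlg K N n) (f : Word N n → C(K, ℂ)) :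
    matAct (S * T) f = matAct S (matAct T f) := by
  ext w y
  simp only [matAct, CStarMatrix.mul_apply, ContinuousMap.sum_apply, ContinuousMap.mul_apply,
    Finset.mul_sum, Finset.sum_mul, mul_assoc]
  exact Finset.sum_comm

theorem one_matAct (f : Word N n → C(K, ℂ)) : matAct (1 : MatAlg K N n) f = f := by
  ext w y
  simp [matAct, CStarMatrix.one_apply]

/-- Adjointness on the free module; it lets `star M` be recognised as linked to `star T` by testing
against `Z`. -/
theorem sum_star_mul_matAct_star (M : MatAlg K N n) (f g : Word N n → C(K, ℂ)) :
    ∑ w, star (g w) * matAct (star M) f w = ∑ w, star (matAct M g w) * f w := by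
  ext y
  simp only [matAct, CStarMatrix.star_apply, ContinuousMap.sum_apply, ContinuousMap.mul_apply,
    Finset.mul_sum, Finset.sum_mul, ContinuousMap.star_apply, star_sum, star_mul']
  rw [Finset.sum_comm]
  exact Finset.sum_congr rfl fun _ _ => Finset.sum_congr rfl fun _ _ => by ring

end MatrixNorm

/-! ### The density of the points with pairwise distinct images -/

section Good

variable {K : Type u} [MetricSpace K] {N : ℕ}

theorem IsSelfSimilarMap.injective {γ : Fin N → C(K, K)} (hγ : IsSelfSimilarMap γ) (j : Fin N) :
    Function.Injective (γ j) := fun x y hxy => by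
  obtain ⟨c', c, h0, -, -, h⟩ := hγ.properContraction j
  have h1 := (h x y).1
  rw [hxy, dist_self] at h1
  exact dist_le_zero.1 (nonpos_of_mul_nonpos_right h1 h0)

/-- On a one-point space all `γ_j` coincide, so with `N ≥ 2` the point is a branch point, and, being
fixed, it is also postcritical. Part (3) of Assumption B forbids this. -/
theorem AssumptionB.nontrivial [Nonempty K] {γ : Fin N → C(K, K)} (hN : 2 ≤ N)
    (hB : AssumptionB γ) : Nontrivial K := by
  by_contra h
  rw [not_nontrivial_iff_subsingleton] at h
  obtain ⟨a⟩ := ‹Nonempty K›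
  have ha : a ∈ branchSet γ :=
    ⟨a, ⟨0, by omega⟩, ⟨1, by omega⟩, by simp, Subsingleton.elim _ _, Subsingleton.elim _ _⟩
  have hmem : a ∈ branchSet γ ∩ postcriticalSet γ :=
    ⟨ha, 1, le_rfl, fun _ => ⟨0, by omega⟩, by rwa [Subsingleton.elim (wordMap γ 1 _ a) a]⟩
  rw [hB.disjoint] at hmem
  exact hmem

theorem IsSelfSimilarMap.exists_contraction {γ : Fin N → C(K, K)} (hγ : IsSelfSimilarMap γ) :
    ∃ c : ℝ, 0 < c ∧ c < 1 ∧ ∀ j x y, dist (γ j x) (γ j y) ≤ c * dist x y := by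
  choose c' c h0 h1 h2 h using hγ.properContraction
  rcases isEmpty_or_nonempty (Fin N) with hE | hE
  -- With no maps, any constant in `(0, 1)` serves; otherwise the largest contraction constant is
  -- taken.
  · exact ⟨1 / 2, by norm_num, by norm_num, fun j => isEmptyElim j⟩
  · obtain ⟨i, -, hi⟩ := Finset.exists_max_image Finset.univ c Finset.univ_nonempty
    refine ⟨c i, (h0 i).trans_le (h1 i), h2 i, fun j x y => ((h j x y).2).trans ?_⟩
    exact mul_le_mul_of_nonneg_right (hi j (Finset.mem_univ j)) dist_nonneg

/-- A compact self-similar set with more than one point has no isolated points. -/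
theorem IsSelfSimilarMap.neBot_punctured_nhds [CompactSpace K] [Nontrivial K]
    {γ : Fin N → C(K, K)} (hγ : IsSelfSimilarMap γ) (x : K) : (nhdsWithin x {x}ᶜ).NeBot := by
  obtain ⟨c, hc0, hc1, hc⟩ := hγ.exists_contraction
  -- Isolation improves under pulling back: if `x = γ_j(a)` is isolated, then `a` is isolated at a
  -- radius larger by the factor `1/c`, since `γ_j` shrinks distances by `c` and is injective. After
  -- `k` steps the radius has grown by `c ^ (-k)`.
  have key : ∀ (k : ℕ) (x : K) (r : ℝ), (∀ y, dist y x < c ^ k * r → y = x) →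
      ∃ z : K, ∀ y, dist y z < r → y = z := by
    intro k
    induction k with
    | zero => intro x r h; exact ⟨x, by simpa using h⟩
    | succ k ih =>
      intro x r h
      obtain ⟨j, a, rfl⟩ := Set.mem_iUnion.1 (hγ.iUnion_range ▸ Set.mem_univ x)
      refine ih a r fun y hy => hγ.injective j (h _ ?_)
      calc dist (γ j y) (γ j a) ≤ c * dist y a := hc j y a
        _ < c * (c ^ k * r) := by gcongr
        _ = c ^ (k + 1) * r := by ring
  by_contra hx
  rw [Filter.not_neBot, ← isOpen_singleton_iff_punctured_nhds, Metric.isOpen_singleton_iff] at hx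
  obtain ⟨ε, hε, hx⟩ := hx
  -- A radius exceeding the diameter: a point isolated at this radius would be the only point of
  -- `K`.
  let R := Metric.diam (Set.univ : Set K) + 1
  have hR : 0 < R := by have := Metric.diam_nonneg (s := (Set.univ : Set K)); positivity
  obtain ⟨k, hk⟩ := exists_pow_lt_of_lt_one (div_pos hε hR) hc1
  rw [lt_div_iff₀ hR] at hk
  obtain ⟨z, hz⟩ := key k x R fun y hy => hx y (hy.trans hk)
  obtain ⟨y, hy⟩ := exists_ne z
  refine hy (hz y (lt_of_le_of_lt (Metric.dist_le_diam_of_mem ?_ (Set.mem_univ y)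
    (Set.mem_univ z)) (lt_add_one _)))
  exact isCompact_univ.isBounded

/-- The points `c` at which the values `γ_w(c)`, `w ∈ Σ^n`, do not branch. -/
def unbranched (γ : Fin N → C(K, K)) : ℕ → Set K
  | 0 => Set.univ
  | n + 1 => {c | (Function.Injective fun j => γ j c) ∧ ∀ j, γ j c ∈ unbranched γ n}

/-- A point fails at stage `n + 1` only if some `γ_j(c)` is a branch point or itself fails at stage
`n`. Both conditions describe preimages of finite sets under injective maps. -/
theorem finite_compl_unbranched {γ : Fin N → C(K, K)} (hγ : IsSelfSimilarMap γ)
    (hB : AssumptionB γ) (n : ℕ) : (unbranched γ n)ᶜ.Finite := by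
  induction n with
  | zero => simp [unbranched]
  | succ n ih =>
    have h : (unbranched γ (n + 1))ᶜ ⊆
        (⋃ j, γ j ⁻¹' branchSet γ) ∪ ⋃ j, γ j ⁻¹' (unbranched γ n)ᶜ := by
      intro c hc
      by_contra h
      simp only [Set.mem_union, Set.mem_iUnion, Set.mem_preimage, Set.mem_compl_iff, not_or,
        not_exists, not_not] at h
      refine hc ⟨fun i j hij => ?_, h.2⟩
      by_contra hne
      exact h.1 i ⟨c, i, j, hne, rfl, hij⟩
    refine Set.Finite.subset (Set.Finite.union ?_ ?_) h
    · exact Set.finite_iUnion fun j => hB.finite_branchSet.preimage (hγ.injective j).injOn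
    · exact Set.finite_iUnion fun j => ih.preimage (hγ.injective j).injOn

/-- Removing finitely many points from a space without isolated points leaves a dense set. -/
theorem dense_unbranched [CompactSpace K] [Nonempty K] (hN : 2 ≤ N) {γ : Fin N → C(K, K)}
    (hγ : IsSelfSimilarMap γ) (hB : AssumptionB γ) (n : ℕ) : Dense (unbranched γ n) := by
  have := hB.nontrivial hN
  have := hγ.neBot_punctured_nhds
  have h := dense_univ.sdiff_finite (finite_compl_unbranched hγ hB n)
  rwa [← Set.compl_eq_univ_sdiff, compl_compl] at h

end Good

/-! ### The range of the coordinates -/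

section Range

variable {K : Type u} [MetricSpace K] [CompactSpace K] {N : ℕ}

/-- At an unbranched point every vector is a value of an element of `Z_γ^{⊗ n}`. -/
theorem exists_coord_eq {γ : Fin N → C(K, K)} (n : ℕ) {c : K} (hc : c ∈ unbranched γ n)
    (v : Word N n → ℂ) : ∃ x : XPow γ n, ∀ w, coord γ n x w c = v w := by
  induction n generalizing c with
  | zero =>
    refine ⟨(ContinuousMap.const K (v default) : C(K, ℂ)), fun w => ?_⟩
    rw [coord_zero, Subsingleton.elim w default]
    rfl
  | succ n ih =>
    -- The points `(γ_i(c), c)` of the cograph are distinct, so some `f` is `1` at one of them and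
    -- `0` at the others. The product below is a Lagrange interpolation with distances as factors,
    -- read off the first coordinate.
    have hsep : ∀ j : Fin N, ∃ f : Corr γ, ∀ i,
        f (cographMap γ i c) = if i = j then 1 else 0 := fun j => by
      let g : K → ℂ := fun z => ∏ i ∈ Finset.univ.erase j,
        ((dist z (γ i c) / dist (γ j c) (γ i c) : ℝ) : ℂ)
      have hg : Continuous g := by fun_prop
      refine ⟨⟨fun p => g p.1.1, by fun_prop⟩, fun i => ?_⟩
      change g (γ i c) = _
      split_ifs with hij
      · subst hij
        refine Finset.prod_eq_one fun k hk => ?_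
        rw [div_self, Complex.ofReal_one]
        exact (dist_pos.2 fun h => (Finset.ne_of_mem_erase hk) (hc.1 h).symm).ne'
      · exact Finset.prod_eq_zero (Finset.mem_erase.2 ⟨hij, Finset.mem_univ i⟩) (by simp)
    choose f hf using hsep
    choose x hx using fun j => ih (hc.2 j) (fun w => v (Fin.snoc w j))
    -- By induction `x j` has the prescribed values at `γ_j(c)`, and `f j` switches on exactly the
    -- words ending in `j`.
    refine ⟨∑ j, XPow.tmul γ (x j) (f j), fun w => ?_⟩
    rw [map_sum, Finset.sum_apply, ContinuousMap.sum_apply,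
      Finset.sum_eq_single (w (Fin.last n))]
    · rw [coord_tmul, hf, if_pos rfl, mul_one, hx, Fin.snoc_init_self]
    · intro j _ hj
      rw [coord_tmul, hf, if_neg hj.symm, mul_zero]
    · simp

theorem sum_norm_coord_sq {γ : Fin N → C(K, K)} {n : ℕ} (x : XPow γ n) (y : K) :
    ∑ w, ‖coord γ n x w y‖ ^ 2 = (inner C(K, ℂ) x x y).re := by
  rw [← sum_coord, sum_star_mul_self_apply, Complex.ofReal_re]

theorem norm_XPow_le {γ : Fin N → C(K, K)} {n : ℕ} (x : XPow γ n) {R : ℝ} (hR : 0 ≤ R) :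
    ‖x‖ ≤ R ↔ ∀ y, ∑ w, ‖coord γ n x w y‖ ^ 2 ≤ R ^ 2 := by
  rw [CStarModule.norm_eq_sqrt_norm_inner_self (A := C(K, ℂ)), sqrt_le_iff_of_nonneg hR,
    ← sum_coord, norm_sum_star_mul_self_le _ (by positivity)]

/-- The left inverse of all the `γ_j` recovers from `γ_w(c)` every intermediate point of the orbit.
So two words with the same value at `c` pass through the same points of the cograph, and an
elementary tensor takes the same factors along both. -/
theorem coord_eq_of_wordMap_eq {γ : Fin N → C(K, K)} (hB : AssumptionB γ) (n : ℕ) (x : XPow γ n)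
    (c : K) (w w' : Word N n) (h : wordMap γ n w c = wordMap γ n w' c) :
    coord γ n x w c = coord γ n x w' c := by
  obtain ⟨g, hg⟩ := hB.exists_leftInverse
  have hiter : ∀ (n : ℕ) (w : Word N n) (c : K), g^[n] (wordMap γ n w c) = c := by
    intro n
    induction n with
    | zero => intro w c; rfl
    | succ n ih =>
      intro w c
      rw [Function.iterate_succ_apply']
      exact (congrArg g (ih (Fin.init w) _)).trans (hg _ _)
  induction n generalizing c with
  | zero => rw [Subsingleton.elim w w']
  | succ n ih =>
    change wordMap γ n (Fin.init w) (γ (w (Fin.last n)) c) =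
      wordMap γ n (Fin.init w') (γ (w' (Fin.last n)) c) at h
    -- Applying the left inverse `n` times strips the first `n` letters. The last letters themselves
    -- may differ, but their values at `c` agree.
    have hlast : γ (w (Fin.last n)) c = γ (w' (Fin.last n)) c := by
      rw [← hiter n (Fin.init w) (γ (w (Fin.last n)) c), h, hiter]
    have hmap : cographMap γ (w (Fin.last n)) c = cographMap γ (w' (Fin.last n)) c :=
      Subtype.ext (Prod.ext hlast rfl)
    rw [hlast] at h
    -- Evaluation of a coordinate at `c` is a bounded functional, so the two evaluations need only
    -- be compared on elementary tensors.
    let ev : Word N (n + 1) → (XPow γ (n + 1) →L[ℂ] ℂ) := fun w =>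
      (ContinuousMap.evalCLM ℂ c).comp
        ((ContinuousLinearMap.proj w).comp (coord γ (n + 1)))
    have hev : ev w = ev w' := InteriorTensor.clm_ext fun x f => by
      change coord γ (n + 1) (XPow.tmul γ x f) w c = coord γ (n + 1) (XPow.tmul γ x f) w' c
      rw [coord_tmul, coord_tmul, hlast, hmap, ih x _ _ _ h]
    exact DFunLike.congr_fun hev x

end Range

/-! ### Operators represented by matrices -/

section Representation

variable {K : Type u} [MetricSpace K] [CompactSpace K] {N : ℕ} {γ : Fin N → C(K, K)} {n : ℕ}

/-- The matrix `M` acts on `Z_γ^{⊗ n}` as the operator `T`. -/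
def Represents (M : MatAlg K N n) (T : LPow γ n) : Prop :=
  ∀ x, matAct M (coord γ n x) = coord γ n (T x)

theorem eq_of_eqOn_unbranched (hd : Dense (unbranched γ n)) {f g : Word N n → C(K, ℂ)}
    (h : ∀ c ∈ unbranched γ n, ∀ w, f w c = g w c) : f = g := by
  funext w
  refine DFunLike.coe_injective (Continuous.ext_on hd (f w).continuous (g w).continuous ?_)
  exact fun c hc => h c hc w

/-- Vectors are determined by their inner products with the elements of `Z_γ^{⊗ n}`. -/
theorem eq_of_sum_star_coord_mul (hd : Dense (unbranched γ n)) {f g : Word N n → C(K, ℂ)}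
    (h : ∀ x : XPow γ n, ∑ w, star (coord γ n x w) * f w = ∑ w, star (coord γ n x w) * g w) :
    f = g := by
  classical
  refine eq_of_eqOn_unbranched hd fun c hc w => ?_
  -- Pairing with an `x` whose value at `c` is the basis vector of `w` extracts the `w`-th
  -- coordinate at `c`.
  obtain ⟨x, hx⟩ := exists_coord_eq n hc (Pi.single w 1)
  have h1 := congrArg (fun a : C(K, ℂ) => a c) (h x)
  simpa [ContinuousMap.sum_apply, hx, Pi.single_apply] using h1

/-- The embedding is constructed only as a `ℂ`-linear map. Its `C(K)`-linearity follows from the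
preservation of inner products, because inner products with `Z` determine a vector. -/
theorem coord_smul (hd : Dense (unbranched γ n)) (a : C(K, ℂ)) (x : XPow γ n) :
    coord γ n (a • x) = fun w => a * coord γ n x w :=
  eq_of_sum_star_coord_mul hd fun z => by
    rw [sum_coord, CStarModule.inner_op_smul_right, ← sum_coord, Finset.mul_sum]
    exact Finset.sum_congr rfl fun w _ => mul_left_comm _ _ _

/-! ### Norms, uniqueness and algebraic operations for representing matrices -/

namespace Represents

/-- The embedding is isometric, which gives `‖T‖ ≤ ‖M‖`. Conversely, at an unbranched point the
elements of `Z` realise every vector, so there `M` is bounded pointwise by `‖T‖`, and density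
finishes. -/
theorem norm_eq (hd : Dense (unbranched γ n)) {M : MatAlg K N n} {T : LPow γ n}
    (h : Represents M T) : ‖M‖ = ‖T‖ := by
  refine le_antisymm ?_ ?_
  · refine norm_le_of_sum_norm_matAct_sq_le M (norm_nonneg _) fun f => ?_
    have hcl : IsClosed {y | ∑ w, ‖matAct M f w y‖ ^ 2 ≤ ‖T‖ ^ 2 * ∑ w, ‖f w y‖ ^ 2} :=
      isClosed_le (by fun_prop) (by fun_prop)
    intro y
    refine hcl.closure_subset_iff.2 (fun c hc => ?_) (hd y)
    -- This `x` agrees with `f` at `c` only and its norm is not controlled. Hence the pointwise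
    -- inequality `Adjointable.inner_apply_apply_le` is needed rather than the operator norm bound.
    obtain ⟨x, hx⟩ := exists_coord_eq n hc fun w => f w c
    have h1 : ∀ w, matAct M f w c = coord γ n (T x) w c := fun w => by
      rw [← h x]
      simp [matAct, hx]
    simp only [Set.mem_ofPred_eq, h1]
    simp only [← hx]
    rw [sum_norm_coord_sq, sum_norm_coord_sq]
    exact T.inner_apply_apply_le x c
  · rw [← Adjointable.norm_toCLM]
    refine ContinuousLinearMap.opNorm_le_bound _ (norm_nonneg _) fun x => ?_
    rw [norm_XPow_le _ (by positivity), ← h x]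
    exact sum_norm_matAct_sq_le M _ (norm_nonneg x) ((norm_XPow_le x (norm_nonneg x)).1 le_rfl)

theorem add {M M' : MatAlg K N n} {T T' : LPow γ n} (h : Represents M T)
    (h' : Represents M' T') : Represents (M + M') (T + T') := fun x => by
  rw [add_matAct, h, h', ← map_add]
  simp

theorem sub {M M' : MatAlg K N n} {T T' : LPow γ n} (h : Represents M T)
    (h' : Represents M' T') : Represents (M - M') (T - T') := fun x => by
  rw [sub_matAct, h, h', ← map_sub]
  simp

theorem smul (c : ℂ) {M : MatAlg K N n} {T : LPow γ n} (h : Represents M T) :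
    Represents (c • M) (c • T) := fun x => by
  rw [smul_matAct, h, ← map_smul]
  simp

theorem mul {M M' : MatAlg K N n} {T T' : LPow γ n} (h : Represents M T)
    (h' : Represents M' T') : Represents (M * M') (T * T') := fun x => by
  rw [mul_matAct, h', h, map_mul]
  rfl

theorem one : Represents (1 : MatAlg K N n) (1 : LPow γ n) := fun x => by
  rw [one_matAct, map_one]
  rfl

theorem zero : Represents (0 : MatAlg K N n) (0 : LPow γ n) := by
  simpa using (one (γ := γ) (n := n)).sub one

theorem sum {ι : Type*} {s : Finset ι} {M : ι → MatAlg K N n} {T : ι → LPow γ n}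
    (h : ∀ i ∈ s, Represents (M i) (T i)) : Represents (∑ i ∈ s, M i) (∑ i ∈ s, T i) := by
  classical
  induction s using Finset.induction_on with
  | empty => simpa using zero
  | insert i s hi ih =>
    rw [Finset.sum_insert hi, Finset.sum_insert hi]
    exact (h i (Finset.mem_insert_self i s)).add
      (ih fun j hj => h j (Finset.mem_insert_of_mem hj))

theorem star (hd : Dense (unbranched γ n)) {M : MatAlg K N n} {T : LPow γ n}
    (h : Represents M T) : Represents (star M) (star T) := fun x =>
  eq_of_sum_star_coord_mul hd fun z => by
    rw [sum_star_mul_matAct_star, h, sum_coord, sum_coord, Adjointable.inner_star_right]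

/-- The difference of the matrices represents `0`, hence has norm `0`. This uniqueness yields all
the identities between representations below. -/
theorem ext (hd : Dense (unbranched γ n)) {M M' : MatAlg K N n} {T : LPow γ n}
    (h : Represents M T) (h' : Represents M' T) : M = M' := by
  rw [← sub_eq_zero, ← norm_eq_zero, (h.sub h').norm_eq hd, sub_self, norm_zero]

theorem rankOne (hd : Dense (unbranched γ n)) (x y : XPow γ n) :
    Represents (matRankOne (coord γ n x) (coord γ n y)) (Adjointable.rankOne x y) := fun z => by
  rw [matAct_matRankOne, Adjointable.rankOne_apply, coord_smul hd, sum_coord]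
  funext w
  exact mul_comm _ _

/-- On `x ⊗ f` the coordinate at `(w, j)` is the `w`-th coordinate of `x` at `γ_j(y)` times a scalar
depending only on `j` and `y`. So `T ⊗ I` leaves the scalar alone and acts in the block of `j` by
`M` composed with `γ_j`. -/
theorem amplify {M : MatAlg K N n} {T : LPow γ n} (h : Represents M T) :
    Represents (matEmb γ n M) (SelfSimilar.amplify γ n T) := by
  have key : (matActL (matEmb γ n M)).comp (coord γ (n + 1)) =
      (coord γ (n + 1)).comp (Adjointable.toCLM (SelfSimilar.amplify γ n T)) := by
    refine InteriorTensor.clm_ext fun x f => ?_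
    change matActL (matEmb γ n M) (coord γ (n + 1) (XPow.tmul γ x f)) =
      coord γ (n + 1) (InteriorTensor.ampl γ (XPow γ n) T (InteriorTensor.tmul x f))
    rw [InteriorTensor.ampl_tmul, matActL_apply]
    ext w y
    change _ = coord γ (n + 1) (XPow.tmul γ (T x) f) w y
    rw [coord_tmul, ← h x]
    simp only [matAct, ContinuousMap.sum_apply, ContinuousMap.mul_apply, coord_tmul]
    -- Words are split into last letter and initial part; block-diagonality kills every last letter
    -- except that of `w`.
    rw [← (Fin.snocEquiv fun _ => Fin N).sum_comp, Fintype.sum_prod_type,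
      Finset.sum_eq_single (w (Fin.last n))]
    · rw [Finset.sum_mul]
      exact Finset.sum_congr rfl fun v _ => by
        simp [matEmb_apply, Fin.snocEquiv, Fin.init_snoc, mul_assoc]
    · intro j _ hj
      exact Finset.sum_eq_zero fun v _ => by simp [matEmb_apply, Fin.snocEquiv, hj.symm]
    · simp
  intro x
  rw [← matActL_apply]
  exact DFunLike.congr_fun key x

theorem amplifyTo {r : ℕ} (hr : r ≤ n) {M : MatAlg K N r} {T : LPow γ r} (h : Represents M T) :
    Represents (blockDiag γ hr M) (SelfSimilar.amplifyTo γ hr T) := by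
  induction n, hr using Nat.le_induction with
  | base => rwa [blockDiag_self, amplifyTo_self]
  | succ n hr ih =>
    rw [blockDiag_succ γ hr, amplifyTo_succ γ hr]
    exact ih.amplify

end Represents

/-! ### Existence of representing matrices and the resulting homomorphisms -/

/-- The compact operators are represented by matrices in `D^{γ^n}`. -/
theorem exists_represents_of_mem_KPow (hd : Dense (unbranched γ n)) (hB : AssumptionB γ)
    {T : LPow γ n} (hT : T ∈ KPow γ n) : ∃ M ∈ matD γ n, Represents M T := by
  -- The graph of the desired representation. It is a closed subspace, and it projects onto a space
  -- containing the span of the rank-one operators.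
  let Q : Submodule ℂ (MatAlg K N n × LPow γ n) :=
    { carrier := {p | p.1 ∈ matD γ n ∧ Represents p.1 p.2}
      zero_mem' := ⟨fun _ _ _ _ _ => by simp, Represents.zero⟩
      add_mem' := fun {p q} hp hq => ⟨fun c w w' h v => by
        simp [(hp.1 c w w' h v).1, (hp.1 c w w' h v).2, (hq.1 c w w' h v).1,
          (hq.1 c w w' h v).2], hp.2.add hq.2⟩
      smul_mem' := fun a {p} hp => ⟨fun c w w' h v => by
        simp [(hp.1 c w w' h v).1, (hp.1 c w w' h v).2], hp.2.smul a⟩ }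
  -- The topology of the matrix algebra is that of entrywise convergence.
  have hev : ∀ w v : Word N n, Continuous fun M : MatAlg K N n => M w v := fun w v =>
    (continuous_apply v).comp (continuous_apply (A := fun _ => Word N n → C(K, ℂ)) w)
  have hD : IsClosed (matD γ n) := by
    simp only [matD, Set.ofPred_forall, Set.ofPred_and]
    refine isClosed_iInter fun c => isClosed_iInter fun w => isClosed_iInter fun w' =>
      isClosed_iInter fun h => isClosed_iInter fun v => IsClosed.inter ?_ ?_ <;>
    exact isClosed_eq ((continuous_eval_const c).comp (hev _ _))
      ((continuous_eval_const c).comp (hev _ _))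
  have hR : IsClosed {p : MatAlg K N n × LPow γ n | Represents p.1 p.2} := by
    simp only [Represents, Set.ofPred_forall]
    refine isClosed_iInter fun x => isClosed_eq (continuous_pi fun w => ?_) ?_
    · exact continuous_finsetSum _ fun w' _ =>
        ((hev w w').comp continuous_fst).mul continuous_const
    · have h1 : Continuous fun T : LPow γ n => Adjointable.toCLM T x :=
        (ContinuousLinearMap.apply ℂ (XPow γ n) x).continuous.comp continuous_subtype_val
      exact (coord γ n).continuous.comp (h1.comp continuous_snd)
  have hQ : IsClosed (Q : Set (MatAlg K N n × LPow γ n)) :=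
    (hD.preimage continuous_fst).inter hR
  have hspan : Submodule.span ℂ (Set.range fun p : XPow γ n × XPow γ n =>
      Adjointable.rankOne (A := C(K, ℂ)) p.1 p.2) ≤ Q.map (LinearMap.snd ℂ _ _) := by
    refine Submodule.span_le.2 ?_
    rintro _ ⟨p, rfl⟩
    refine ⟨(matRankOne (coord γ n p.1) (coord γ n p.2), _), ⟨fun c w w' h v => ?_,
      Represents.rankOne hd p.1 p.2⟩, rfl⟩
    simp [matRankOne_apply, coord_eq_of_wordMap_eq hB n _ c w w' h]
  obtain ⟨t, ht, htT⟩ := mem_closure_iff_seq_limit.1 (closure_mono hspan hT)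
  choose p hpQ hpt using ht
  have hdist : ∀ i j, dist (p i).1 (p j).1 = dist (t i) (t j) := fun i j => by
    -- By the equality of norms the matrices are exactly as far apart as the operators, so a
    -- convergent sequence of operators gives a Cauchy sequence of matrices. Their limit represents
    -- `T` because the graph is closed.
    rw [dist_eq_norm, dist_eq_norm, ← hpt i, ← hpt j]
    exact ((hpQ i).2.sub (hpQ j).2).norm_eq hd
  have hcauchy : CauchySeq fun i => (p i).1 := by
    rw [Metric.cauchySeq_iff]
    simpa only [hdist] using Metric.cauchySeq_iff.1 htT.cauchySeq
  obtain ⟨M, hM⟩ := cauchySeq_tendsto_of_complete hcauchy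
  have hlim : Filter.Tendsto p Filter.atTop (nhds (M, T)) := by
    refine hM.prodMk_nhds (htT.congr fun i => (hpt i).symm)
  exact ⟨M, hQ.mem_of_tendsto hlim (Filter.Eventually.of_forall hpQ)⟩

theorem exists_represents_of_mem_finiteCore (hd : ∀ n, Dense (unbranched γ n))
    (hB : AssumptionB γ) {T : LPow γ n} (hT : T ∈ finiteCore γ n) :
    ∃ M, Represents M T := by
  obtain ⟨t, rfl⟩ := hT
  choose M _ hM using fun r : Fin (n + 1) =>
    exists_represents_of_mem_KPow (hd r) hB (t r).2
  exact ⟨_, Represents.sum fun r _ => (hM r).amplifyTo (Nat.le_of_lt_succ r.2)⟩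

/-- The matrix representation of the compact operators. -/
def compactsRep (hd : Dense (unbranched γ n)) (hB : AssumptionB γ) :
    KPow γ n →⋆ₙₐ[ℂ] MatAlg K N n :=
  -- The matrix is merely chosen, but uniqueness makes the choice harmless: each homomorphism law
  -- holds because both sides represent the same operator.
  have h (T : KPow γ n) := (exists_represents_of_mem_KPow hd hB T.2).choose_spec.2
  { toFun := fun T => (exists_represents_of_mem_KPow hd hB T.2).choose
    map_zero' := (h 0).ext hd Represents.zero
    map_add' := fun S T => (h (S + T)).ext hd ((h S).add (h T))
    map_mul' := fun S T => (h (S * T)).ext hd ((h S).mul (h T))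
    map_smul' := fun c T => (h (c • T)).ext hd ((h T).smul c)
    map_star' := fun T => (h (star T)).ext hd ((h T).star hd) }

theorem compactsRep_mem_matD (hd : Dense (unbranched γ n)) (hB : AssumptionB γ) (T : KPow γ n) :
    compactsRep hd hB T ∈ matD γ n :=
  (exists_represents_of_mem_KPow hd hB T.2).choose_spec.1

theorem represents_compactsRep (hd : Dense (unbranched γ n)) (hB : AssumptionB γ)
    (T : KPow γ n) : Represents (compactsRep hd hB T) (T : LPow γ n) :=
  (exists_represents_of_mem_KPow hd hB T.2).choose_spec.2

/-- The matrix representation of the finite core. -/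
def finiteCoreRep (hd : ∀ n, Dense (unbranched γ n)) (hB : AssumptionB γ) (n : ℕ) :
    finiteCore γ n →⋆ₐ[ℂ] MatAlg K N n :=
  have h (T : finiteCore γ n) := (exists_represents_of_mem_finiteCore hd hB T.2).choose_spec
  { toFun := fun T => (exists_represents_of_mem_finiteCore hd hB T.2).choose
    map_one' := (h 1).ext (hd n) Represents.one
    map_zero' := (h 0).ext (hd n) Represents.zero
    map_add' := fun S T => (h (S + T)).ext (hd n) ((h S).add (h T))
    map_mul' := fun S T => (h (S * T)).ext (hd n) ((h S).mul (h T))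
    commutes' := fun c => by
      refine (h (algebraMap ℂ _ c)).ext (hd n) ?_
      rw [Algebra.algebraMap_eq_smul_one, Algebra.algebraMap_eq_smul_one]
      exact Represents.one.smul c
    map_star' := fun T => (h (star T)).ext (hd n) ((h T).star (hd n)) }

theorem represents_finiteCoreRep (hd : ∀ n, Dense (unbranched γ n)) (hB : AssumptionB γ)
    (T : finiteCore γ n) : Represents (finiteCoreRep hd hB n T) (T : LPow γ n) :=
  (exists_represents_of_mem_finiteCore hd hB T.2).choose_spec

theorem isometry_finiteCoreRep (hd : ∀ n, Dense (unbranched γ n)) (hB : AssumptionB γ) :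
    Isometry (finiteCoreRep hd hB n) :=
  AddMonoidHomClass.isometry_of_norm _ fun T => (represents_finiteCoreRep hd hB T).norm_eq (hd n)

/-- Both matrices represent `T ⊗ I`. -/
theorem finiteCoreRep_coreEmb (hd : ∀ n, Dense (unbranched γ n)) (hB : AssumptionB γ)
    (T : finiteCore γ n) :
    finiteCoreRep hd hB (n + 1) (coreEmb γ n T) = matEmb γ n (finiteCoreRep hd hB n T) :=
  (represents_finiteCoreRep hd hB _).ext (hd (n + 1)) (represents_finiteCoreRep hd hB T).amplify

end Representation

/-! ### Functoriality of inductive limits -/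

namespace InductiveSystem

variable {S S' : InductiveSystem.{u}}

/-- The map of threads induced by a morphism of inductive systems. -/
def PreLimit.map (f : ∀ n, S.alg n →⋆ₐ[ℂ] S'.alg n)
    (hf : ∀ n x, f (n + 1) (S.map n x) = S'.map n (f n x)) : S.PreLimit →⋆ₐ[ℂ] S'.PreLimit where
  toFun x := ⟨fun n => f n (x.entry n), x.2.imp fun _ hm n hn =>
    (congrArg (f (n + 1)) (hm n hn)).trans (hf n _)⟩
  map_one' := Subtype.ext (funext fun n => map_one (f n))
  map_zero' := Subtype.ext (funext fun n => map_zero (f n))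
  map_add' x y := Subtype.ext (funext fun n => map_add (f n) (x.entry n) (y.entry n))
  map_mul' x y := Subtype.ext (funext fun n => map_mul (f n) (x.entry n) (y.entry n))
  commutes' c := Subtype.ext (funext fun n => AlgHomClass.commutes (f n) c)
  map_star' x := Subtype.ext (funext fun n => map_star (f n) (x.entry n))

/-- The seminorm of a thread is the limit of the norms of its entries, and these are preserved one
by one. -/
theorem PreLimit.isometry_map {f : ∀ n, S.alg n →⋆ₐ[ℂ] S'.alg n}
    (hf : ∀ n x, f (n + 1) (S.map n x) = S'.map n (f n x)) (hiso : ∀ n, Isometry (f n)) :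
    Isometry (PreLimit.map f hf) :=
  AddMonoidHomClass.isometry_of_norm _ fun x =>
    tendsto_nhds_unique (tendsto_norm (PreLimit.map f hf x))
      ((tendsto_norm x).congr fun n =>
        ((AddMonoidHomClass.isometry_iff_norm (f n)).1 (hiso n) (x.entry n)).symm)

/-- The continuous extension of a *-homomorphism of threads to the limits. -/
def Limit.mapFun (g : S.PreLimit →⋆ₐ[ℂ] S'.PreLimit) : S.Limit → S'.Limit :=
  UniformSpace.Completion.map g

theorem Limit.continuous_mapFun (g : S.PreLimit →⋆ₐ[ℂ] S'.PreLimit) :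
    Continuous (Limit.mapFun g) :=
  UniformSpace.Completion.continuous_map

/-- The completed map extends `g` because `g` is uniformly continuous; this is what the isometry
hypothesis supplies here. -/
theorem Limit.mapFun_mk {g : S.PreLimit →⋆ₐ[ℂ] S'.PreLimit} (hg : Isometry g) (x : S.PreLimit) :
    Limit.mapFun g (mk x) = mk (g x) :=
  UniformSpace.Completion.map_coe hg.uniformContinuous x

theorem Limit.mapFun_one {g : S.PreLimit →⋆ₐ[ℂ] S'.PreLimit} (hg : Isometry g) :
    Limit.mapFun g 1 = 1 := by
  have h := mapFun_mk hg 1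
  rwa [map_one] at h

theorem Limit.mapFun_smul {g : S.PreLimit →⋆ₐ[ℂ] S'.PreLimit} (hg : Isometry g) (c : ℂ)
    (x : S.Limit) : Limit.mapFun g (c • x) = c • Limit.mapFun g x := by
  have hc := continuous_mapFun g
  refine denseRange_mk.induction_on x
    (isClosed_eq (hc.comp (continuous_const_smul c)) (hc.const_smul c)) fun x => ?_
  rw [← mk_smul, mapFun_mk hg, mapFun_mk hg, map_smul, mk_smul]

/-- The *-homomorphism of inductive limits induced by an isometric morphism of inductive systems. -/
def Limit.map (f : ∀ n, S.alg n →⋆ₐ[ℂ] S'.alg n)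
    (hf : ∀ n x, f (n + 1) (S.map n x) = S'.map n (f n x)) (hiso : ∀ n, Isometry (f n)) :
    S.Limit →⋆ₐ[ℂ] S'.Limit :=
  have hg := PreLimit.isometry_map hf hiso
  have hc := continuous_mapFun (PreLimit.map f hf)
  { toFun := mapFun (PreLimit.map f hf)
    map_one' := mapFun_one hg
    map_zero' := by
      have h := mapFun_mk hg 0
      rwa [map_zero] at h
    map_add' := fun x y => by
      refine denseRange_mk.induction_on₂ (isClosed_eq (hc.comp continuous_add)
        ((hc.comp continuous_fst).add (hc.comp continuous_snd))) (fun x y => ?_) x y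
      rw [← mk_add, mapFun_mk hg, mapFun_mk hg, mapFun_mk hg, map_add, mk_add]
    map_mul' := fun x y => by
      refine denseRange_mk.induction_on₂ (isClosed_eq (hc.comp continuous_mul)
        ((hc.comp continuous_fst).mul (hc.comp continuous_snd))) (fun x y => ?_) x y
      rw [← mk_mul, mapFun_mk hg, mapFun_mk hg, mapFun_mk hg, map_mul, mk_mul]
    commutes' := fun c => by
      have h := mapFun_smul hg c 1
      rw [mapFun_one hg] at h
      rwa [Algebra.algebraMap_eq_smul_one, Algebra.algebraMap_eq_smul_one]
    map_star' := fun x => by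
      refine denseRange_mk.induction_on x (isClosed_eq (hc.comp continuous_starFun)
        (continuous_starFun.comp hc)) fun x => ?_
      rw [star_mk, mapFun_mk hg, mapFun_mk hg, map_star, star_mk] }

variable {f : ∀ n, S.alg n →⋆ₐ[ℂ] S'.alg n}
  (hf : ∀ n x, f (n + 1) (S.map n x) = S'.map n (f n x)) (hiso : ∀ n, Isometry (f n))

theorem Limit.map_mk (x : S.PreLimit) :
    Limit.map f hf hiso (mk x) = mk (PreLimit.map f hf x) :=
  mapFun_mk (PreLimit.isometry_map hf hiso) x

theorem Limit.isometry_map : Isometry (Limit.map f hf hiso) :=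
  (PreLimit.isometry_map hf hiso).completion_map

theorem map_mapTo (hf : ∀ n x, f (n + 1) (S.map n x) = S'.map n (f n x))
    {n m : ℕ} (h : n ≤ m) (x : S.alg n) :
    f m (mapTo h x) = mapTo h (f n x) := by
  induction m, h using Nat.le_induction with
  | base => rw [mapTo_self, mapTo_self]
  | succ m h ih => rw [mapTo_succ h, mapTo_succ h, hf, ih]

theorem Limit.map_of (n : ℕ) (x : S.alg n) :
    Limit.map f hf hiso (Limit.of n x) = Limit.of n (f n x) := by
  rw [Limit.of, Limit.map_mk, Limit.of]
  congr 1
  refine Subtype.ext (funext fun m => ?_)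
  -- The thread of `x` is padded with zeros before index `n`; these entries match since each `f m`
  -- sends `0` to `0`.
  change f m (if h : n ≤ m then mapTo h x else 0) = if h : n ≤ m then mapTo h (f n x) else 0
  split_ifs with h
  · exact map_mapTo hf h x
  · exact map_zero (f m)

end InductiveSystem

end SelfSimilar

end

/-! ### The matrix representation of the core -/

theorem mainTheorem4 {K : Type*} [MetricSpace K] [CompactSpace K] [Nonempty K] {N : ℕ} (hN : 2 ≤ N)
    (γ : Fin N → C(K, K)) (hγ : SelfSimilar.IsSelfSimilarMap γ) (hB : SelfSimilar.AssumptionB γ) :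
    ∃ (Ω : ∀ r : ℕ, SelfSimilar.KPow γ r →⋆ₙₐ[ℂ] SelfSimilar.MatAlg K N r)
      (P : ∀ n : ℕ, SelfSimilar.finiteCore γ n →⋆ₐ[ℂ] SelfSimilar.MatAlg K N n),
      -- `Ω r` is an isometric *-homomorphism into `D^{γ^r}`, inverse to restriction to `Z_γ^{⊗ r}`
      (∀ (r : ℕ) (T : SelfSimilar.KPow γ r),
        ‖Ω r T‖ = ‖(T : SelfSimilar.LPow γ r)‖ ∧
        Ω r T ∈ SelfSimilar.matD γ r ∧
        ∀ x : SelfSimilar.XPow γ r,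
          SelfSimilar.matAct (Ω r T) (SelfSimilar.coord γ r x) =
            SelfSimilar.coord γ r ((T : SelfSimilar.LPow γ r) x)) ∧
      -- `Ω r (θ^Z_{x,y}) = θ^Y_{x,y}`
      (∀ (r : ℕ) (x y : SelfSimilar.XPow γ r),
        Ω r ⟨SelfSimilar.Adjointable.rankOne x y, SelfSimilar.Adjointable.rankOne_mem x y⟩ =
          SelfSimilar.matRankOne (SelfSimilar.coord γ r x) (SelfSimilar.coord γ r y)) ∧
      -- `P n` is isometric
      (∀ n : ℕ, Isometry (P n)) ∧
      -- `P n (∑ T_r ⊗ I_{n-r}) = ∑ Ω^{(n,r)}(T_r)`, for every expression of an element of `ℱ^{(n)}`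
      (∀ (n : ℕ) (t : ∀ r : Fin (n + 1), SelfSimilar.KPow γ r),
        P n (SelfSimilar.finiteCore.sum γ t) =
          ∑ r : Fin (n + 1), SelfSimilar.blockDiag γ (Nat.le_of_lt_succ r.2) (Ω r (t r))) ∧
      -- compatibility with the inclusions
      (∀ (n : ℕ) (T : SelfSimilar.finiteCore γ n),
        P (n + 1) (SelfSimilar.coreEmb γ n T) = SelfSimilar.matEmb γ n (P n T)) ∧
      -- the representation of the core
      ∃ Pinf : SelfSimilar.Core γ →⋆ₐ[ℂ] SelfSimilar.MatInfinity γ,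
        Isometry Pinf ∧
        ∀ (n : ℕ) (T : SelfSimilar.finiteCore γ n),
          Pinf (SelfSimilar.Core.of γ n T) = SelfSimilar.MatInfinity.of γ n (P n T) := by
  -- Self-similarity, `N ≥ 2` and parts (2) and (3) of Assumption B act only through this density.
  -- Part (1) is what puts the matrices of compact operators into `D^{γ^r}`.
  have hd := SelfSimilar.dense_unbranched hN hγ hB
  have hΩ (r : ℕ) := SelfSimilar.represents_compactsRep (hd r) hB
  have hP (n : ℕ) := SelfSimilar.represents_finiteCoreRep (n := n) hd hB
  refine ⟨fun r => SelfSimilar.compactsRep (hd r) hB, SelfSimilar.finiteCoreRep hd hB,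
    fun r T => ⟨(hΩ r T).norm_eq (hd r), SelfSimilar.compactsRep_mem_matD (hd r) hB T, hΩ r T⟩,
    fun r x y => (hΩ r _).ext (hd r) (SelfSimilar.Represents.rankOne (hd r) x y),
    fun n => SelfSimilar.isometry_finiteCoreRep hd hB,
    -- Both sides represent `∑ T_r ⊗ I_{n - r}`, so uniqueness gives the formula for every
    -- expression of the element at once.
    fun n t => (hP n _).ext (hd n) (SelfSimilar.Represents.sum fun r _ =>
      (hΩ r (t r)).amplifyTo (Nat.le_of_lt_succ r.2)),
    fun n => SelfSimilar.finiteCoreRep_coreEmb hd hB,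
    SelfSimilar.InductiveSystem.Limit.map (S := SelfSimilar.coreSystem γ)
      (S' := SelfSimilar.matSystem γ) (SelfSimilar.finiteCoreRep hd hB)
      (fun n => SelfSimilar.finiteCoreRep_coreEmb hd hB)
      (fun n => SelfSimilar.isometry_finiteCoreRep hd hB),
    SelfSimilar.InductiveSystem.Limit.isometry_map _ _,
    fun n T => SelfSimilar.InductiveSystem.Limit.map_of (S := SelfSimilar.coreSystem γ)
      (S' := SelfSimilar.matSystem γ) _ _ n T⟩
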